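/- **Definitions.** A *state space* is a tuple $(A,A_+,\mathcal U,E)$ where $A$ is a finite-dimensional real vector space, $A_+\subset A$ is a closed convex cone of full dimension with $A_+\cap(-A_+)=\{0\}$, $\mathcal U$ is a linear functional that is strictly positive on $A_+\setminus\{0\}$, and $E$ (the allowed effects) is a closed convex set of linear functionals of full dimension $\dim A$, containing $\mathcal U$, with $0\le \mathcal M\le\mathcal U$ on $A_+$ for all $\mathcal M\in E$. Its set of normalized states is $\Omega=\{\omega\in A_+:\mathcal U(\omega)=1\}$; pure states are extreme points of $\Omega$. A *dynamical state space* carries in addition a compact group $\mathcal G$ of invertible linear maps of $A$ with $G\Omega=\Omega$ and $E\circ G=E$ for all $G\in\mathcal G$. Two dynamical state spaces are *equivalent* if a linear bijection $L:A\to B$ satisfies $LA_+=B_+$, $\mathcal U^B\circ L=\mathcal U^A$, $E_B\circ L=E_A$ and $\mathcal G_B=L\mathcal G_AL^{-1}$. Let $d\ge2$, and consider a dynamical state space with a continuous representation $R\mapsto G_R$ of $SO(d)$ by elements of $\mathcal G$ and a distinguished effect $\mathcal M\in E$. Put $\mathcal M_Y:=\mathcal M\circ G_{Y^{-1}}$ for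 $Y\in SO(d)$. A *codeword* for $X\in SO(d)$ is a state $\omega\in\Omega$ with $\mathcal M_X(\omega)>\mathcal M_Y(\omega)$ for all $Y\ne X$. The system is a *frame bit for spatial dimension $d$* if * (Assumption 1') there is a codeword for $\mathbf 1$; * (Assumption 2') if $\omega\neq\omega'$ are codewords for the same $Y_0\in SO(d)$, then there are finitely many $0<\lambda_j<1$ with $\sum_j\lambda_j=1$ and pairwise distinct $R_j\in SO(d)$ such that $\mathcal M_Y(\omega')=\sum_j\lambda_j\mathcal M_{R_jY}(\omega)$ for all $Y\in SO(d)$, or the same holds with $\omega,\omega'$ interchanged. The system is a *direction bit* with distinguished unit vector $x\in\mathbb R^d$ (here in the single-system sense, without any condition on composites of two direction bits) if $\mathcal M\circ G_{R^{-1}}=:\mathcal N_{Rx}$ depends only on $Rx$ and, with $L_y:=\mathcal N_y-\mathcal N_{-y}$ for unit vectors $y$, * (Assumption 1) there is $\omega\in\Omega$ with $L_x(\omega)>L_y(\omega)$ for all $y\ne x$; * (Assumption 2) if $\omega,\omega'\in\Omega$ are such that $y\mapsto L_y(\omega)$ and $y\mapsto L_y(\omega')$ both have their unique maximum at the same $y_0$,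 with the same maximal value, then $\omega=\omega'$. Finally let $\Delta(\omega):=\max_Y\mathcal M_Y(\omega)-\min_Y\mathcal M_Y(\omega)$. **Theorem.** 1. Let $d\ge 2$ and let $A$ be a frame bit for spatial dimension $d$. For every $X\in SO(d)$ there is a unique codeword $\omega_X$ for $X$ with the largest value of $\Delta$ among all codewords for $X$, and the pure states of $A$ are exactly the states $\omega_X$, $X\in SO(d)$. For some $D$, $A$ is equivalent, via some linear bijection $L$, to a dynamical state space on $\mathbb R\times\mathbb R^D$ with order unit $(x_0,r)\mapsto x_0$ and normalized states $\{(1,r): |r|\le1\}$, i.e. a Euclidean $D$-dimensional unit ball. Writing $L\omega=(1,\hat\omega)$ for $\omega\in\Omega$, the map $X\mapsto\hat\omega_X$ is a homeomorphism of $SO(d)$ onto the unit sphere $S^{D-1}$. Moreover $D=2$ and $d=2$. 2. For $d=2$ and every unit vector $x\in\mathbb R^2$, the system is a frame bit if and only if it is a direction bit with distinguished direction $x$. 3. Frame bits for spatial dimension $d=2$ exist. -/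

import Mathlib

noncomputable section

/-- A state space carried by the finite-dimensional real vector space `A`: the proper cone of
unnormalized states, the order unit, and the set of allowed effects. The norm on `A` only serves to
name the canonical topology of a finite-dimensional space, for which every linear map is continuous.
-/
structure StateSpace (A : Type*) [NormedAddCommGroup A] [NormedSpace ℝ A]
    [FiniteDimensional ℝ A] where
  /-- the cone of unnormalized states -/
  cone : PointedCone ℝ A
  cone_closed : IsClosed (cone : Set A)
  cone_full : Submodule.span ℝ (cone : Set A) = ⊤
  cone_salient : ∀ x ∈ cone, -x ∈ cone → x = 0
  /-- the order unit -/
  unit : A →L[ℝ] ℝ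
  unit_pos : ∀ x ∈ cone, x ≠ 0 → 0 < unit x
  /-- the set of allowed effects -/
  effects : Set (A →L[ℝ] ℝ)
  effects_closed : IsClosed effects
  effects_convex : Convex ℝ effects
  effects_full : affineSpan ℝ effects = ⊤
  unit_mem_effects : unit ∈ effects
  effects_nonneg : ∀ M ∈ effects, ∀ x ∈ cone, 0 ≤ M x
  effects_le_unit : ∀ M ∈ effects, ∀ x ∈ cone, M x ≤ unit x

/-- The set `Ω` of normalized states. -/
def StateSpace.states {A : Type*} [NormedAddCommGroup A] [NormedSpace ℝ A]
    [FiniteDimensional ℝ A] (S : StateSpace A) : Set A :=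
  {ω | ω ∈ S.cone ∧ S.unit ω = 1}

/-- A dynamical state space: a state space with a compact group of linear maps, the reversible
transformations, that preserve the normalized states and the allowed effects. -/
structure DynamicalStateSpace (A : Type*) [NormedAddCommGroup A] [NormedSpace ℝ A]
    [FiniteDimensional ℝ A] extends StateSpace A where
  /-- the group of reversible transformations -/
  transf : Subgroup (A ≃L[ℝ] A)
  transf_compact : IsCompact ((fun g : A ≃L[ℝ] A => (g : A →L[ℝ] A)) '' (transf : Set (A ≃L[ℝ] A)))
  transf_states : ∀ g ∈ transf, (fun ω => g ω) '' toStateSpace.states = toStateSpace.states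
  transf_effects : ∀ g ∈ transf,
    (fun M : A →L[ℝ] ℝ => M.comp (g : A →L[ℝ] A)) '' effects = effects

/-- The bijective linear map `L` is an equivalence of the dynamical state spaces `S` and `T`. -/
structure IsDynamicalEquiv {A B : Type*} [NormedAddCommGroup A] [NormedSpace ℝ A]
    [FiniteDimensional ℝ A] [NormedAddCommGroup B] [NormedSpace ℝ B] [FiniteDimensional ℝ B]
    (S : DynamicalStateSpace A) (T : DynamicalStateSpace B) (L : A ≃L[ℝ] B) : Prop where
  map_cone : (fun x => L x) '' (S.cone : Set A) = (T.cone : Set B)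
  unit_comp : T.unit.comp (L : A →L[ℝ] B) = S.unit
  effects_comp : (fun M : B →L[ℝ] ℝ => M.comp (L : A →L[ℝ] B)) '' T.effects = S.effects
  transf_conj : (fun g : A ≃L[ℝ] A => (L.symm.trans g).trans L) '' (S.transf : Set (A ≃L[ℝ] A)) =
    (T.transf : Set (B ≃L[ℝ] B))

/-- A dynamical state space on `ℝ × ℝ^D` whose normalized states are exactly the vectors `(1, r)`
with `r` in the closed Euclidean unit ball of `ℝ^D`, and whose order unit is `(x₀, r) ↦ x₀`. -/
def IsEuclideanBall {D : ℕ} (T : DynamicalStateSpace (ℝ × EuclideanSpace ℝ (Fin D))) : Prop :=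
  (∀ p : ℝ × EuclideanSpace ℝ (Fin D), T.unit p = p.1) ∧
    T.states = {p : ℝ × EuclideanSpace ℝ (Fin D) | p.1 = 1 ∧ ‖p.2‖ ≤ 1}

/-- The rotation group `SO(d)`; its elements are also the (positively oriented orthonormal) frames
of `ℝ^d`. -/
abbrev SOd (d : ℕ) : Type := Matrix.specialOrthogonalGroup (Fin d) ℝ

/-- A dynamical state space with a distinguished continuous representation `R ↦ G R` of `SO(d)` by
reversible transformations, and a distinguished allowed effect `M`. -/
structure RotationStateSpace (d : ℕ) (A : Type*) [NormedAddCommGroup A] [NormedSpace ℝ A]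
    [FiniteDimensional ℝ A] extends DynamicalStateSpace A where
  /-- the representation of the rotation group -/
  G : SOd d →* (A ≃L[ℝ] A)
  G_continuous : Continuous (fun R : SOd d => (G R : A →L[ℝ] A))
  G_mem : ∀ R, G R ∈ transf
  /-- the distinguished effect -/
  M : A →L[ℝ] ℝ
  M_mem : M ∈ effects

namespace RotationStateSpace

variable {d : ℕ} {A : Type*} [NormedAddCommGroup A] [NormedSpace ℝ A] [FiniteDimensional ℝ A]

/-- The effect `M_Y = M ∘ G_{Y⁻¹}` of the device with orientation `Y`. -/
def frameEffect (S : RotationStateSpace d A) (Y : SOd d) : A →L[ℝ] ℝ :=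
  S.M.comp (S.G Y⁻¹ : A →L[ℝ] A)

/-- `ω` is a codeword for the frame `X`: a normalized state for which `Y ↦ M_Y(ω)` has its unique
maximum at `Y = X`. -/
def IsCodeword (S : RotationStateSpace d A) (X : SOd d) (ω : A) : Prop :=
  ω ∈ S.states ∧ ∀ Y, Y ≠ X → S.frameEffect Y ω < S.frameEffect X ω

/-- The function `Y ↦ M_Y(ω')` is a proper finite mixture of pairwise distinct rotated copies of
`Y ↦ M_Y(ω)`. -/
def IsNoisier (S : RotationStateSpace d A) (ω' ω : A) : Prop :=
  ∃ (n : ℕ) (lam : Fin n → ℝ) (R : Fin n → SOd d),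
    (∀ j, 0 < lam j ∧ lam j < 1) ∧ ∑ j, lam j = 1 ∧ Function.Injective R ∧
      ∀ Y, S.frameEffect Y ω' = ∑ j, lam j * S.frameEffect (R j * Y) ω

/-- Frame bits (for spatial dimension `d ≥ 2`). -/
structure IsFrameBit (S : RotationStateSpace d A) : Prop where
  /-- some state encodes the frame `1` -/
  exists_codeword : ∃ ω, S.IsCodeword 1 ω
  /-- of two different states that encode the same frame, one is noisier than the other -/
  noisier : ∀ ω ω' : A, ω ≠ ω' → ∀ Y₀ : SOd d, S.IsCodeword Y₀ ω → S.IsCodeword Y₀ ω' →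
    S.IsNoisier ω' ω ∨ S.IsNoisier ω ω'

/-- `Δ(ω) = max_Y M_Y(ω) - min_Y M_Y(ω)`; both extrema are attained as `SO(d)` is compact. -/
def spread (S : RotationStateSpace d A) (ω : A) : ℝ :=
  (⨆ Y, S.frameEffect Y ω) - (⨅ Y, S.frameEffect Y ω)

/-- `ω` is a codeword for the frame `X` with the largest value of `Δ` among all codewords for `X`.
-/
def IsMaximalCodeword (S : RotationStateSpace d A) (X : SOd d) (ω : A) : Prop :=
  S.IsCodeword X ω ∧ ∀ φ, S.IsCodeword X φ → S.spread φ ≤ S.spread ω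

/-- Given effects `N y` labelled by directions `y`, the function `y ↦ L_y(ω) = N_y(ω) - N_{-y}(ω)`
on unit vectors has its unique maximum at `y = y₀`. -/
def IsUniqueMaxDirection (N : EuclideanSpace ℝ (Fin d) → (A →L[ℝ] ℝ)) (ω : A)
    (y₀ : EuclideanSpace ℝ (Fin d)) : Prop :=
  ‖y₀‖ = 1 ∧ ∀ y, ‖y‖ = 1 → y ≠ y₀ → N y ω - N (-y) ω < N y₀ ω - N (-y₀) ω

/-- Direction bits (for spatial dimension `d ≥ 2`) with distinguished direction `x`, in the sense
of encoding and minimality; no condition on pairs of direction bits is included. The effect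
`M ∘ G_{R⁻¹}` must depend only on the direction `R x`; it is called `N (R x)`. As `SO(d)` acts
transitively on unit vectors for `d ≥ 2`, this determines `N` on all unit vectors, and the other
values of `N` play no role. -/
def IsDirectionBit (S : RotationStateSpace d A) (x : EuclideanSpace ℝ (Fin d)) : Prop :=
  ∃ N : EuclideanSpace ℝ (Fin d) → (A →L[ℝ] ℝ),
    (∀ R : SOd d, N (Matrix.toEuclideanLin (R : Matrix (Fin d) (Fin d) ℝ) x) =
      S.M.comp (S.G R⁻¹ : A →L[ℝ] A)) ∧
    (∃ ω ∈ S.states, IsUniqueMaxDirection N ω x) ∧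
    (∀ ω ∈ S.states, ∀ ω' ∈ S.states, ∀ y₀ : EuclideanSpace ℝ (Fin d),
      IsUniqueMaxDirection N ω y₀ → IsUniqueMaxDirection N ω' y₀ →
      N y₀ ω - N (-y₀) ω = N y₀ ω' - N (-y₀) ω' → ω = ω')

end RotationStateSpace

end

noncomputable section

open Set Filter Topology MeasureTheory

/-! Call a state a weak peak if no rotation increases `M` on it. Noise strictly lowers the maximum
of a codeword, so two codewords for `1` with equal values of `M` coincide; this is all that the
structure theorem takes from Assumption 2'. Mixtures of a weak peak with a codeword are again
codewords, so this injectivity forces all weak peaks onto one segment, from an invariant state `μ`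
(the Haar barycentre of an orbit) to `μ + w` (`exists_isRadial`). Every state can be rotated into a
weak peak, hence `Ω` consists of the points `μ + t • G Y w` with `0 ≤ t ≤ 1`.

In invariant Euclidean coordinates the orbit of `w` lies on a sphere, is balanced about the origin,
spans, and has a convex star-shaped hull; by separation it is the whole sphere
(`range_eq_sphere_of_convex`). So `Ω` is a ball and `SO(d)` acts simply transitively on its
boundary. A nonzero vector fixed by an involution `Z ≠ 1` would contradict freeness, so such a `Z`
acts as `-1` on directions (`map_eq_neg_of_involution`). For `d ≥ 3` two different half turns would
then agree on `w`; thus `d = 2`. There the quarter turn acts as a complex structure, and by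
commutativity and transitivity every `G R + G R⁻¹` is scalar, which confines the orbit to a plane;
thus `D = 2`.

Conversely, for `d = 2` the rotation by `π` is the reflection in `μ`. Mixing it with the identity
shrinks a codeword towards `μ`, so radial structure implies Assumption 2'; moreover the
direction-bit functional agrees on states with `2 M` up to a constant. Frame bits and direction bits
are therefore both characterized by the same radial structure, and the unit disc has it. -/

instance instIsTopologicalGroupSOd (d : ℕ) : IsTopologicalGroup (SOd d) where
  continuous_inv := by
    refine Continuous.subtype_mk (f := fun R : SOd d => star (R : Matrix (Fin d) (Fin d) ℝ)) ?_ _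
    exact continuous_star.comp continuous_subtype_val

/-! ### Compactness of the rotation group -/

theorem abs_entry_le_one_of_mem_SOd {d : ℕ} (R : SOd d) (i j : Fin d) :
    |(R : Matrix (Fin d) (Fin d) ℝ) i j| ≤ 1 := by
  have h := (Matrix.mem_specialOrthogonalGroup_iff.1 R.2).1
  have h := (Matrix.mem_orthogonalGroup_iff _ _).1 h
  have h1 : ∑ k, (R : Matrix (Fin d) (Fin d) ℝ) i k * (R : Matrix (Fin d) (Fin d) ℝ) i k = 1 := by
    have := congrFun (congrFun h i) i
    simpa [Matrix.mul_apply, Matrix.star_apply] using this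
  have h2 := Finset.single_le_sum (f := fun k => (R : Matrix (Fin d) (Fin d) ℝ) i k *
    (R : Matrix (Fin d) (Fin d) ℝ) i k) (fun k _ => mul_self_nonneg _) (Finset.mem_univ j)
  rw [abs_le_one_iff_mul_self_le_one]
  exact h2.trans h1.le

theorem isClosed_SOd (d : ℕ) :
    IsClosed (Matrix.specialOrthogonalGroup (Fin d) ℝ : Set (Matrix (Fin d) (Fin d) ℝ)) := by
  have : (Matrix.specialOrthogonalGroup (Fin d) ℝ : Set (Matrix (Fin d) (Fin d) ℝ)) =
      {R | R * star R = 1} ∩ {R | R.det = 1} := by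
    ext R
    simp [Matrix.mem_specialOrthogonalGroup_iff, Matrix.mem_orthogonalGroup_iff,
      Matrix.star_eq_conjTranspose]
  rw [this]
  exact (isClosed_eq (continuous_id.mul continuous_star) continuous_const).inter
    (isClosed_eq continuous_id.matrix_det continuous_const)

instance instCompactSpaceSOd (d : ℕ) : CompactSpace (SOd d) := by
  refine isCompact_iff_compactSpace.1 ?_
  have hK : IsCompact (Set.univ.pi fun _ : Fin d => Set.univ.pi fun _ : Fin d =>
      Set.Icc (-1 : ℝ) 1) :=
    isCompact_univ_pi fun _ => isCompact_univ_pi fun _ => isCompact_Icc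
  refine hK.of_isClosed_subset (isClosed_SOd d) fun R hR => ?_
  simp only [Set.mem_pi, Set.mem_univ, true_implies]
  exact fun i j => abs_le.1 (abs_entry_le_one_of_mem_SOd ⟨R, hR⟩ i j)

/-! ### Averaging over a compact group -/

section Average

variable {K : Type*} [Group K] [TopologicalSpace K] [IsTopologicalGroup K] [CompactSpace K]

theorem exists_haar_probability [MeasurableSpace K] [BorelSpace K] :
    ∃ ν : Measure K, IsProbabilityMeasure ν ∧ ν.IsMulLeftInvariant ∧ ν.IsOpenPosMeasure :=
  ⟨Measure.haarMeasure ⊤, ⟨by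
    have := Measure.haarMeasure_self (K₀ := (⊤ : TopologicalSpace.PositiveCompacts K))
    simpa using this⟩, inferInstance, inferInstance⟩

variable {A : Type*} [NormedAddCommGroup A] [NormedSpace ℝ A] [FiniteDimensional ℝ A]

omit [Group K] [IsTopologicalGroup K] [CompactSpace K] [FiniteDimensional ℝ A] in
theorem continuous_rep_apply {G : K → (A ≃L[ℝ] A)}
    (hG : Continuous fun k => (G k : A →L[ℝ] A)) (a : A) : Continuous fun k => G k a :=
  (ContinuousLinearMap.apply ℝ A a).continuous.comp hG

/-- The barycentre of an orbit of a compact group in a compact convex set. -/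
theorem exists_fixed_barycentre {G : K →* (A ≃L[ℝ] A)}
    (hG : Continuous fun k => (G k : A →L[ℝ] A)) {Ω : Set A} (hc : IsCompact Ω)
    (hconv : Convex ℝ Ω) (hinv : ∀ k, ∀ ω ∈ Ω, G k ω ∈ Ω) {ω₀ : A} (h₀ : ω₀ ∈ Ω) :
    ∃ μ ∈ Ω, (∀ k, G k μ = μ) ∧
      (∀ (f : A →L[ℝ] ℝ) (c : ℝ), (∀ k, f (G k ω₀) ≤ c) → f μ ≤ c) ∧
      (∀ f : A →L[ℝ] ℝ, (∀ k, f (G k ω₀) ≤ f μ) → ∀ k, f (G k ω₀) = f μ) := by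
  let _ : MeasurableSpace K := borel K
  have : BorelSpace K := ⟨rfl⟩
  obtain ⟨ν, hν1, hν2, hν3⟩ := exists_haar_probability (K := K)
  have hcont := continuous_rep_apply hG ω₀
  have hint : Integrable (fun k => G k ω₀) ν :=
    hcont.integrable_of_hasCompactSupport (HasCompactSupport.of_compactSpace _)
  have hcomm : ∀ f : A →L[ℝ] ℝ, ∫ k, f (G k ω₀) ∂ν = f (∫ k, G k ω₀ ∂ν) :=
    fun f => f.integral_comp_comm hint
  have hintf : ∀ f : A →L[ℝ] ℝ, Integrable (fun k => f (G k ω₀)) ν := fun f => f.integrable_comp hint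
  refine ⟨∫ k, G k ω₀ ∂ν, hconv.integral_mem hc.isClosed (.of_forall fun k => hinv k _ h₀) hint,
    fun k => ?_, fun f c hf => ?_, fun f hf k => ?_⟩
  · have := (G k : A →L[ℝ] A).integral_comp_comm hint
    have h2 := integral_mul_left_eq_self (μ := ν) (fun k => G k ω₀) k
    simp only [map_mul] at h2
    exact this.symm.trans h2
  · rw [← hcomm]
    calc ∫ k, f (G k ω₀) ∂ν ≤ ∫ _, c ∂ν := integral_mono (hintf f) (integrable_const c) hf
      _ = c := by simp
  -- A continuous nonnegative function with a positive value has positive integral, because Haar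
  -- measure charges open sets; here the integral is zero.
  · by_contra hne
    have hpos := Continuous.integral_pos_of_hasCompactSupport_nonneg_nonzero (μ := ν)
      (f := fun k => f (∫ k, G k ω₀ ∂ν) - f (G k ω₀)) (x := k)
      (continuous_const.sub (f.continuous.comp hcont)) (HasCompactSupport.of_compactSpace _)
      (fun k => sub_nonneg.2 (hf k)) (sub_ne_zero.2 (Ne.symm hne))
    rw [integral_sub (integrable_const _) (hintf f), hcomm] at hpos
    simp at hpos

/-- A compact group acting linearly preserves some inner product. -/
theorem exists_invariant_core {G : K →* (A ≃L[ℝ] A)}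
    (hG : Continuous fun k => (G k : A →L[ℝ] A)) :
    ∃ c : InnerProductSpace.Core ℝ A, ∀ k a, c.inner (G k a) (G k a) = c.inner a a := by
  let _ : MeasurableSpace K := borel K
  have : BorelSpace K := ⟨rfl⟩
  obtain ⟨ν, hν1, hν2, hν3⟩ := exists_haar_probability (K := K)
  -- With `k⁻¹` here, acting on both arguments by the group amounts to a left translation of the
  -- integration variable.
  let b : A → A → K → ℝ := fun u v k =>
    inner ℝ (toEuclidean (G k⁻¹ u)) (toEuclidean (G k⁻¹ v))
  have hcont : ∀ u v, Continuous (b u v) := fun u v =>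
    (toEuclidean.continuous.comp ((continuous_rep_apply hG u).comp continuous_inv)).inner
      (toEuclidean.continuous.comp ((continuous_rep_apply hG v).comp continuous_inv))
  have hint : ∀ u v, Integrable (b u v) ν := fun u v =>
    (hcont u v).integrable_of_hasCompactSupport (HasCompactSupport.of_compactSpace _)
  refine ⟨{
    inner := fun u v => ∫ k, b u v k ∂ν
    conj_inner_symm := fun u v => ?_
    re_inner_nonneg := fun u => ?_
    add_left := fun u v w => ?_
    smul_left := fun u v r => ?_
    definite := fun u hu => ?_ }, fun k a => ?_⟩
  · simp only [conj_trivial]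
    exact integral_congr_ae (.of_forall fun k => real_inner_comm _ _)
  · simp only [RCLike.re_to_real]
    exact integral_nonneg fun k => real_inner_self_nonneg
  · rw [← integral_add (hint _ _) (hint _ _)]
    exact integral_congr_ae (.of_forall fun k => by simp [b, inner_add_left])
  · simp only [conj_trivial]
    rw [← integral_const_mul]
    exact integral_congr_ae (.of_forall fun k => by simp [b, inner_smul_left])
  · by_contra hne
    have hpos := Continuous.integral_pos_of_hasCompactSupport_nonneg_nonzero (μ := ν)
      (f := b u u) (x := 1) (hcont u u) (HasCompactSupport.of_compactSpace _)
      (fun k => real_inner_self_nonneg) (by simpa [b] using hne)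
    exact hpos.ne' hu
  · have h2 := integral_mul_left_eq_self (μ := ν) (b a a) k⁻¹
    change ∫ l, b (G k a) (G k a) l ∂ν = ∫ l, b a a l ∂ν
    rw [← h2]
    refine integral_congr_ae (.of_forall fun l => ?_)
    simp only [b, mul_inv_rev, inv_inv, map_mul]
    rfl

end Average

/-! ### Compactness and spanning of the normalized states -/

namespace StateSpace

variable {A : Type*} [NormedAddCommGroup A] [NormedSpace ℝ A] [FiniteDimensional ℝ A]

theorem convex_states (S : StateSpace A) : Convex ℝ S.states := by
  intro x hx y hy a b ha hb hab
  refine ⟨S.cone.add_mem (S.cone.smul_mem ha hx.1) (S.cone.smul_mem hb hy.1), ?_⟩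
  simp [hx.2, hy.2, hab]

theorem isClosed_states (S : StateSpace A) : IsClosed S.states :=
  S.cone_closed.inter (isClosed_eq S.unit.continuous continuous_const)

/-- The constant is the minimum of the order unit on the compact set of cone vectors of norm one.
This bounds the normalized states. -/
theorem exists_mul_norm_le_unit (S : StateSpace A) :
    ∃ m : ℝ, 0 < m ∧ ∀ x ∈ S.cone, m * ‖x‖ ≤ S.unit x := by
  have hC : IsCompact ((S.cone : Set A) ∩ Metric.sphere 0 1) :=
    (isCompact_sphere 0 1).inter_left S.cone_closed
  have key : ∀ m : ℝ, (∀ y ∈ (S.cone : Set A) ∩ Metric.sphere 0 1, m ≤ S.unit y) →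
      ∀ x ∈ S.cone, m * ‖x‖ ≤ S.unit x := by
    intro m hm x hx
    rcases eq_or_ne x 0 with rfl | h0
    · simp
    have hn : 0 < ‖x‖ := norm_pos_iff.2 h0
    have h1 := hm (‖x‖⁻¹ • x) ⟨S.cone.smul_mem (inv_nonneg.2 hn.le) hx, by
      simp [norm_smul, hn.ne']⟩
    rw [map_smul, smul_eq_mul, inv_mul_eq_div, le_div_iff₀ hn] at h1
    exact h1
  rcases ((S.cone : Set A) ∩ Metric.sphere 0 1).eq_empty_or_nonempty with he | hne
  · exact ⟨1, one_pos, key 1 (by simp [he])⟩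
  · obtain ⟨y, hy, hmin⟩ := hC.exists_isMinOn hne S.unit.continuous.continuousOn
    refine ⟨S.unit y, S.unit_pos y hy.1 ?_, key _ fun z hz => hmin hz⟩
    rintro rfl
    simpa using hy.2

theorem isCompact_states (S : StateSpace A) : IsCompact S.states := by
  obtain ⟨m, hm, h⟩ := S.exists_mul_norm_le_unit
  refine (isCompact_closedBall (0 : A) m⁻¹).of_isClosed_subset S.isClosed_states fun x hx => ?_
  have := h x hx.1
  rw [hx.2] at this
  rw [mem_closedBall_zero_iff, ← one_div, le_div_iff₀ hm]
  linarith

theorem exists_smul_state (S : StateSpace A) {x : A} (hx : x ∈ S.cone) (h0 : x ≠ 0) :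
    (S.unit x)⁻¹ • x ∈ S.states := by
  have := S.unit_pos x hx h0
  exact ⟨S.cone.smul_mem (inv_nonneg.2 this.le) hx, by simp [this.ne']⟩

/-- A functional that vanishes on all states vanishes. -/
theorem eq_zero_of_forall_states (S : StateSpace A) (f : A →ₗ[ℝ] ℝ)
    (hf : ∀ ω ∈ S.states, f ω = 0) : f = 0 := by
  refine LinearMap.ext_on S.cone_full fun x hx => ?_
  rcases eq_or_ne x 0 with rfl | h0
  · simp
  have h := hf _ (S.exists_smul_state hx h0)
  have := S.unit_pos x hx h0
  simpa [this.ne'] using h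

end StateSpace

namespace DynamicalStateSpace

variable {A : Type*} [NormedAddCommGroup A] [NormedSpace ℝ A] [FiniteDimensional ℝ A]

theorem map_mem_states (S : DynamicalStateSpace A) {g : A ≃L[ℝ] A} (hg : g ∈ S.transf) {ω : A}
    (hω : ω ∈ S.states) : g ω ∈ S.states := by
  rw [← S.transf_states g hg]
  exact ⟨ω, hω, rfl⟩

theorem unit_map (S : DynamicalStateSpace A) {g : A ≃L[ℝ] A} (hg : g ∈ S.transf) (a : A) :
    S.unit (g a) = S.unit a := by
  have h := S.eq_zero_of_forall_states
    ((S.unit.comp (g : A →L[ℝ] A) - S.unit : A →L[ℝ] ℝ) : A →ₗ[ℝ] ℝ) fun ω hω => by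
      have := (S.map_mem_states hg hω).2
      simp [this, hω.2]
  have h := LinearMap.congr_fun h a
  simpa [sub_eq_zero] using h

end DynamicalStateSpace

/-! ### Peaks and the radial structure of the state set -/

section Radial

variable {K : Type*} [Group K] {A : Type*} [NormedAddCommGroup A] [NormedSpace ℝ A]

/-- `ω ∈ Ω` is a point at which `Y ↦ F (G Y⁻¹ ω)` has its unique maximum at `Y = X`. -/
def IsPeak (Ω : Set A) (G : K →* (A ≃L[ℝ] A)) (F : A →L[ℝ] ℝ) (X : K) (ω : A) : Prop :=
  ω ∈ Ω ∧ ∀ Y, Y ≠ X → F (G Y⁻¹ ω) < F (G X⁻¹ ω)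

theorem rep_mul_apply (G : K →* (A ≃L[ℝ] A)) (X Y : K) (a : A) : G (X * Y) a = G X (G Y a) := by
  rw [map_mul]
  rfl

theorem rep_one_apply (G : K →* (A ≃L[ℝ] A)) (a : A) : G 1 a = a := by
  rw [map_one]
  rfl

theorem rep_inv_apply_apply (G : K →* (A ≃L[ℝ] A)) (X : K) (a : A) : G X⁻¹ (G X a) = a := by
  rw [← rep_mul_apply, inv_mul_cancel, rep_one_apply]

theorem rep_apply_inv_apply (G : K →* (A ≃L[ℝ] A)) (X : K) (a : A) : G X (G X⁻¹ a) = a := by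
  rw [← rep_mul_apply, mul_inv_cancel, rep_one_apply]

variable {Ω : Set A} {G : K →* (A ≃L[ℝ] A)} {F : A →L[ℝ] ℝ}

theorem isPeak_one_iff {ω : A} :
    IsPeak Ω G F 1 ω ↔ ω ∈ Ω ∧ ∀ Y, Y ≠ 1 → F (G Y ω) < F ω := by
  refine and_congr_right fun _ => ⟨fun h Y hY => ?_, fun h Y hY => ?_⟩
  · have := h Y⁻¹ (by simpa using hY)
    rwa [inv_inv, inv_one, rep_one_apply] at this
  · rw [inv_one, rep_one_apply]
    exact h _ (by simpa using hY)

/-- A convex combination of a weak peak and a peak is a peak. -/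
theorem IsPeak.lineMap {φ ω : A} (hconv : Convex ℝ Ω) (hω : IsPeak Ω G F 1 ω) (hφ : φ ∈ Ω)
    (hle : ∀ Y, F (G Y φ) ≤ F φ) {t : ℝ} (h0 : 0 < t) (h1 : t ≤ 1) :
    IsPeak Ω G F 1 ((1 - t) • φ + t • ω) := by
  rw [isPeak_one_iff] at hω ⊢
  refine ⟨hconv hφ hω.1 (by linarith) h0.le (by ring), fun Y hY => ?_⟩
  have h2 := mul_lt_mul_of_pos_left (hω.2 Y hY) h0
  have h3 := mul_le_mul_of_nonneg_left (hle Y) (sub_nonneg.2 h1)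
  simp only [map_add, map_smul, smul_eq_mul]
  linarith

theorem IsPeak.le {ω : A} (hω : IsPeak Ω G F 1 ω) (Y : K) : F (G Y ω) ≤ F ω := by
  rcases eq_or_ne Y 1 with rfl | h
  · rw [rep_one_apply]
  · exact ((isPeak_one_iff.1 hω).2 Y h).le

/-- The mixture of `p` and `r` with the same `F`-value as `q` is itself a peak, so injectivity
identifies it with `q`. -/
theorem eq_lineMap_of_isPeak_of_between (hconv : Convex ℝ Ω)
    (hinj : ∀ ω ω', IsPeak Ω G F 1 ω → IsPeak Ω G F 1 ω' → F ω = F ω' → ω = ω')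
    {p q r : A} (hp : IsPeak Ω G F 1 p) (hq : IsPeak Ω G F 1 q) (hr : IsPeak Ω G F 1 r)
    (h1 : F p ≤ F q) (h2 : F q ≤ F r) (h3 : F p < F r) :
    q = (1 - (F q - F p) / (F r - F p)) • p + ((F q - F p) / (F r - F p)) • r := by
  have hpos : 0 < F r - F p := sub_pos.2 h3
  rcases h1.eq_or_lt with he | hlt
  · rw [← hinj _ _ hp hq he]
    simp
  · refine hinj _ _ hq (hr.lineMap hconv hp.1 hp.le (div_pos (sub_pos.2 hlt) hpos) ?_) ?_
    · rw [div_le_one hpos]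
      linarith
    · simp only [map_add, map_smul, smul_eq_mul]
      field_simp
      ring

/-- Of three peaks, the one with the middle `F`-value lies between the other two; the cases are the
possible positions of `F r`. -/
theorem exists_eq_lineMap_of_isPeak (hconv : Convex ℝ Ω)
    (hinj : ∀ ω ω', IsPeak Ω G F 1 ω → IsPeak Ω G F 1 ω' → F ω = F ω' → ω = ω')
    {p q r : A} (hp : IsPeak Ω G F 1 p) (hq : IsPeak Ω G F 1 q) (hr : IsPeak Ω G F 1 r)
    (h : F p < F q) : ∃ s : ℝ, r = p + s • (q - p) := by
  have solve : ∀ (x y z : A) (t : ℝ), y = (1 - t) • x + t • z → t ≠ 0 →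
      z = x + t⁻¹ • (y - x) := by
    rintro x y z t rfl ht
    have : (1 - t) • x + t • z - x = t • (z - x) := by module
    rw [this, inv_smul_smul₀ ht]
    abel
  rcases le_total (F r) (F p) with h1 | h1
  · have hrq : F r < F q := h1.trans_lt h
    have := eq_lineMap_of_isPeak_of_between hconv hinj hr hp hq h1 h.le hrq
    set t := (F p - F r) / (F q - F r) with ht
    have ht1 : 1 - t ≠ 0 := by
      rw [ht, one_sub_div (sub_pos.2 hrq).ne']
      exact (div_pos (by linarith) (sub_pos.2 hrq)).ne'
    refine ⟨1 - (1 - t)⁻¹, ?_⟩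
    have h2 := solve q p r (1 - t) (by rw [this]; module) ht1
    rw [h2]
    module
  rcases le_total (F r) (F q) with h2 | h2
  · have := eq_lineMap_of_isPeak_of_between hconv hinj hp hr hq h1 h2 h
    set t := (F r - F p) / (F q - F p)
    exact ⟨t, by rw [this]; module⟩
  · have hpr : F p < F r := h.trans_le h2
    have := eq_lineMap_of_isPeak_of_between hconv hinj hp hq hr h.le h2 hpr
    exact ⟨_, solve p q r _ this (div_pos (sub_pos.2 h) (sub_pos.2 hpr)).ne'⟩

/-- `μ` is an invariant point of `Ω`, and the weak peaks at `1` are the points of the segment from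
`μ` to `μ + w`. -/
structure IsRadial (Ω : Set A) (G : K →* (A ≃L[ℝ] A)) (F : A →L[ℝ] ℝ) (μ w : A) : Prop where
  convex : Convex ℝ Ω
  invariant : ∀ k, ∀ ω ∈ Ω, G k ω ∈ Ω
  mem : μ ∈ Ω
  fixed : ∀ k, G k μ = μ
  isPeak : IsPeak Ω G F 1 (μ + w)
  exists_eq_of_forall_le : ∀ φ ∈ Ω, (∀ Y, F (G Y φ) ≤ F φ) → ∃ t ∈ Icc (0 : ℝ) 1, φ = μ + t • w
  balanced : ∀ f : A →L[ℝ] ℝ, (∀ k, f (G k w) ≤ 0) → ∀ k, f (G k w) = 0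

/-- The centre is the barycentre of the orbit of some peak. All weak peaks lie on a ray from it, and
compactness yields the end point `μ + w`. -/
theorem exists_isRadial [TopologicalSpace K] [IsTopologicalGroup K] [CompactSpace K]
    [Nontrivial K] [FiniteDimensional ℝ A] (hG : Continuous fun k => (G k : A →L[ℝ] A))
    (hc : IsCompact Ω) (hconv : Convex ℝ Ω) (hinv : ∀ k, ∀ ω ∈ Ω, G k ω ∈ Ω)
    (hex : ∃ ω, IsPeak Ω G F 1 ω)
    (hinj : ∀ ω ω', IsPeak Ω G F 1 ω → IsPeak Ω G F 1 ω' → F ω = F ω' → ω = ω') :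
    ∃ μ w, IsRadial Ω G F μ w := by
  obtain ⟨ω₀, h₀⟩ := hex
  obtain ⟨μ, hμ, hfix, hle, hbal⟩ := exists_fixed_barycentre hG hc hconv hinv h₀.1
  obtain ⟨Z, hZ⟩ := exists_ne (1 : K)
  have hμle : ∀ Y, F (G Y μ) ≤ F μ := fun Y => by rw [hfix]
  have hZ0 := (isPeak_one_iff.1 h₀).2 Z hZ
  -- `μ` is only a weak peak; averaging with `ω₀` gives a genuine one, to which injectivity applies.
  -- The same device is used for `φ` below.
  have hμ' : IsPeak Ω G F 1 ((1 - (1 / 2 : ℝ)) • μ + (1 / 2 : ℝ) • ω₀) :=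
    h₀.lineMap hconv hμ hμle (by norm_num) (by norm_num)
  -- Equality would give the midpoint and `ω₀` the same value, hence `μ = ω₀`, but an invariant
  -- point is no strict peak.
  have hlt : F μ < F ω₀ := by
    refine lt_of_le_of_ne (hle F _ h₀.le) fun he => ?_
    have h1 := hinj _ _ hμ' h₀ (by simp only [map_add, map_smul, smul_eq_mul]; rw [he]; ring)
    have h2 : μ = ω₀ := by
      have : (1 / 2 : ℝ) • (μ - ω₀) = 0 := by
        rw [← sub_eq_zero] at h1
        rw [← h1]
        module
      simpa [sub_eq_zero] using this
    rw [← h2, hfix] at hZ0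
    exact lt_irrefl _ hZ0
  have hline : ∀ φ ∈ Ω, (∀ Y, F (G Y φ) ≤ F φ) → ∃ s : ℝ, 0 ≤ s ∧ φ = μ + s • (ω₀ - μ) := by
    intro φ hφ hφle
    have hφ' := h₀.lineMap hconv hφ hφle (t := 1 / 2) (by norm_num) (by norm_num)
    obtain ⟨s, hs⟩ := exists_eq_lineMap_of_isPeak hconv hinj hμ' h₀ hφ' (by
      simp only [map_add, map_smul, smul_eq_mul]; linarith)
    have hφs : φ = μ + s • (ω₀ - μ) := by
      have : φ = (2 : ℝ) • ((1 - (1 / 2 : ℝ)) • φ + (1 / 2 : ℝ) • ω₀) - ω₀ := by module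
      rw [this, hs]
      module
    -- A negative `s` would turn the strict maximum of `ω₀` into a minimum, against the comparison
    -- with `Z`.
    refine ⟨s, ?_, hφs⟩
    have h3 := hφle Z
    rw [hφs] at h3
    simp only [map_add, map_smul, map_sub, hfix, smul_eq_mul] at h3
    have : 0 ≤ s * (F ω₀ - F (G Z ω₀)) := by linarith
    exact nonneg_of_mul_nonneg_left this (sub_pos.2 hZ0)
  have hKc : IsCompact (Ω ∩ {φ | ∀ Y, F (G Y φ) ≤ F φ}) := by
    refine hc.inter_right ?_
    simp only [ofPred_forall]
    exact isClosed_iInter fun Y =>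
      isClosed_le (F.continuous.comp (G Y).continuous) F.continuous
  -- Along the ray `F` increases, so its maximizer among the weak peaks is the far end point of the
  -- segment.
  obtain ⟨ω₁, h₁, hmax⟩ := hKc.exists_isMaxOn ⟨ω₀, h₀.1, h₀.le⟩ F.continuous.continuousOn
  obtain ⟨s₁, hs₁, he₁⟩ := hline ω₁ h₁.1 h₁.2
  have hFline : ∀ s : ℝ, F (μ + s • (ω₀ - μ)) = F μ + s * (F ω₀ - F μ) := fun s => by simp
  have hs1 : 1 ≤ s₁ := by
    have := hmax (show ω₀ ∈ _ from ⟨h₀.1, h₀.le⟩)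
    simp only [mem_ofPred_eq, he₁, hFline] at this
    by_contra hcon
    nlinarith [sub_pos.2 hlt]
  have hs1pos : 0 < s₁ := by linarith
  refine ⟨μ, s₁ • (ω₀ - μ), hconv, hinv, hμ, hfix, ?_, fun φ hφ hφle => ?_, fun f hf k => ?_⟩
  · rw [← he₁, isPeak_one_iff]
    refine ⟨h₁.1, fun Y hY => ?_⟩
    have := mul_pos hs1pos (sub_pos.2 ((isPeak_one_iff.1 h₀).2 Y hY))
    rw [he₁]
    simp only [map_add, map_smul, map_sub, hfix, smul_eq_mul]
    linarith
  · obtain ⟨s, hs, he⟩ := hline φ hφ hφle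
    refine ⟨s / s₁, ⟨by positivity, ?_⟩, ?_⟩
    · rw [div_le_one hs1pos]
      have := hmax (show φ ∈ _ from ⟨hφ, hφle⟩)
      simp only [mem_ofPred_eq, he₁, he, hFline] at this
      by_contra! hcon
      nlinarith [sub_pos.2 hlt]
    · rw [smul_smul, div_mul_cancel₀ _ hs1pos.ne', ← he]
  · simp only [map_smul, map_sub, hfix, smul_eq_mul] at hf ⊢
    have := hbal f (fun k => by
      have := hf k
      by_contra! hcon
      nlinarith [mul_pos hs1pos (sub_pos.2 hcon)]) k
    rw [this]
    ring

namespace IsRadial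

variable {μ w : A}

theorem map_lt (h : IsRadial Ω G F μ w) {Y : K} (hY : Y ≠ 1) : F (G Y w) < F w := by
  have := (isPeak_one_iff.1 h.isPeak).2 Y hY
  simpa [h.fixed] using this

/-- Strictness of the peak makes the stabilizer of `w` trivial. -/
theorem injective (h : IsRadial Ω G F μ w) : Function.Injective fun Y => G Y w := by
  intro X Y hXY
  by_contra hne
  have h1 := h.map_lt (Y := X⁻¹ * Y) (by rwa [Ne, inv_mul_eq_one])
  rw [rep_mul_apply, ← show G X w = G Y w from hXY, rep_inv_apply_apply] at h1
  exact lt_irrefl _ h1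

theorem mem_of_mem_Icc (h : IsRadial Ω G F μ w) (Y : K) {t : ℝ} (ht : t ∈ Icc (0 : ℝ) 1) :
    μ + t • G Y w ∈ Ω := by
  have h1 := h.invariant Y _ h.isPeak.1
  have h2 := h.convex h.mem h1 (sub_nonneg.2 ht.2) ht.1 (by ring)
  rw [map_add, h.fixed] at h2
  convert h2 using 1
  module

/-- Moving `φ` to the point of its orbit where `F` is largest produces a weak peak. -/
theorem exists_eq [TopologicalSpace K] [IsTopologicalGroup K] [CompactSpace K]
    (hG : Continuous fun k => (G k : A →L[ℝ] A)) (h : IsRadial Ω G F μ w) {φ : A} (hφ : φ ∈ Ω) :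
    ∃ Y, ∃ t ∈ Icc (0 : ℝ) 1, φ = μ + t • G Y w := by
  obtain ⟨Y, -, hY⟩ := isCompact_univ.exists_isMaxOn (s := (univ : Set K)) ⟨1, mem_univ _⟩
    (f := fun k => F (G k φ))
    (F.continuous.comp ((ContinuousLinearMap.apply ℝ A φ).continuous.comp hG)).continuousOn
  obtain ⟨t, ht, he⟩ := h.exists_eq_of_forall_le (G Y φ) (h.invariant Y φ hφ) fun Z => by
    rw [← rep_mul_apply]
    exact hY (mem_univ _)
  refine ⟨Y⁻¹, t, ht, ?_⟩
  rw [← rep_inv_apply_apply G Y φ, he, map_add, h.fixed, map_smul]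

theorem isPeak_iff (h : IsRadial Ω G F μ w) [Nontrivial K] {X : K} {φ : A} :
    IsPeak Ω G F X φ ↔ ∃ t ∈ Ioc (0 : ℝ) 1, φ = μ + t • G X w := by
  constructor
  · rintro ⟨hφ, hlt⟩
    obtain ⟨t, ht, he⟩ := h.exists_eq_of_forall_le (G X⁻¹ φ) (h.invariant _ φ hφ) fun Z => by
      rw [← rep_mul_apply]
      rcases eq_or_ne (Z * X⁻¹)⁻¹ X with hZ | hZ
      · rw [show Z * X⁻¹ = X⁻¹ by rw [← inv_inv (Z * X⁻¹), hZ]]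
      · have := hlt _ hZ
        rw [inv_inv] at this
        exact this.le
    have he' : φ = μ + t • G X w := by
      rw [← rep_apply_inv_apply G X φ, he, map_add, h.fixed, map_smul]
    refine ⟨t, ⟨ht.1.lt_of_ne ?_, ht.2⟩, he'⟩
    rintro rfl
    obtain ⟨Y, hY⟩ := exists_ne X
    have := hlt Y hY
    rw [he', zero_smul, add_zero, h.fixed, h.fixed] at this
    exact lt_irrefl _ this
  · rintro ⟨t, ht, rfl⟩
    refine ⟨h.mem_of_mem_Icc X ⟨ht.1.le, ht.2⟩, fun Y hY => ?_⟩
    have := mul_lt_mul_of_pos_left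
      (h.map_lt (Y := Y⁻¹ * X) (by rwa [Ne, inv_mul_eq_one])) ht.1
    simp only [map_add, map_smul, h.fixed, smul_eq_mul, ← rep_mul_apply, inv_mul_cancel,
      rep_one_apply]
    linarith

end IsRadial

end Radial

/-! ### Orbits that fill a sphere, and invariant Euclidean coordinates -/

/-- A balanced, spanning, compact family of unit vectors whose star-shaped hull about `0` is convex
exhausts the unit sphere. -/
theorem range_eq_sphere_of_convex {K : Type*} [TopologicalSpace K] [CompactSpace K]
    {E : Type*} [NormedAddCommGroup E] [InnerProductSpace ℝ E] {o : K → E} (ho : Continuous o)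
    (h1 : ∀ k, ‖o k‖ = 1) (hconv : Convex ℝ {x | ∃ k, ∃ t ∈ Icc (0 : ℝ) 1, x = t • o k})
    (hspan : ∀ f : E →L[ℝ] ℝ, (∀ k, f (o k) = 0) → f = 0)
    (hbal : ∀ f : E →L[ℝ] ℝ, (∀ k, f (o k) ≤ 0) → ∀ k, f (o k) = 0) :
    range o = Metric.sphere 0 1 := by
  refine Subset.antisymm (range_subset_iff.2 fun k => by simp [h1]) fun x hx => ?_
  have hx1 : ‖x‖ = 1 := by simpa using hx
  set P : Set E := {x | ∃ k, x = ‖x‖ • o k} with hP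
  have hmem : ∀ x, x ∈ P ↔ ∃ k, ∃ s : ℝ, 0 ≤ s ∧ x = s • o k := by
    refine fun x => ⟨fun ⟨k, hk⟩ => ⟨k, ‖x‖, norm_nonneg _, hk⟩, ?_⟩
    rintro ⟨k, s, hs, rfl⟩
    exact ⟨k, by rw [norm_smul, h1, Real.norm_of_nonneg hs, mul_one]⟩
  -- The cone is the projection of a closed set along the compact factor `K`.
  have hclosed : IsClosed P := by
    have : P = Prod.fst '' {p : E × K | p.1 = ‖p.1‖ • o p.2} := by
      ext y
      simp [hP]
    rw [this]
    refine isClosedMap_fst_of_compactSpace _ (isClosed_eq continuous_fst ?_)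
    exact (continuous_norm.comp continuous_fst).smul (ho.comp continuous_snd)
  have hPconv : Convex ℝ P := by
    intro y hy z hz a b ha hb hab
    obtain ⟨k, s, hs, rfl⟩ := (hmem y).1 hy
    obtain ⟨l, t, ht, rfl⟩ := (hmem z).1 hz
    -- Dividing by `s + t + 1` moves both points into the star-shaped hull; the summand `1` keeps
    -- the divisor nonzero.
    have hm : 0 < s + t + 1 := by linarith
    obtain ⟨j, r, hr, he⟩ := hconv (x := (s / (s + t + 1)) • o k) (y := (t / (s + t + 1)) • o l)
      ⟨k, _, ⟨by positivity, by rw [div_le_one hm]; linarith⟩, rfl⟩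
      ⟨l, _, ⟨by positivity, by rw [div_le_one hm]; linarith⟩, rfl⟩ ha hb hab
    refine (hmem _).2 ⟨j, (s + t + 1) * r, mul_nonneg hm.le hr.1, ?_⟩
    rw [mul_smul, ← he]
    simp only [smul_add, smul_smul]
    congr 2 <;> field_simp
  by_contra hxo
  have hxP : x ∉ P := by
    rintro ⟨k, hk⟩
    rw [hx1, one_smul] at hk
    exact hxo ⟨k, hk.symm⟩
  obtain ⟨f, u, hf, hu⟩ := geometric_hahn_banach_closed_point hPconv hclosed hxP
  rcases isEmpty_or_nonempty K with hK | ⟨⟨k₀⟩⟩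
  · have := hspan (innerSL ℝ x) fun k => hK.elim k
    have := congrArg (fun g : E →L[ℝ] ℝ => g x) this
    simp [hx1] at this
  have hu0 : 0 < u := by
    have := hf 0 ((hmem 0).2 ⟨k₀, 0, le_rfl, by simp⟩)
    simpa using this
  -- A functional bounded above on a cone is nonpositive there. Balance and spanning then force `f =
  -- 0`, which cannot separate.
  have hle : ∀ k, f (o k) ≤ 0 := by
    intro k
    by_contra! hcon
    have := hf _ ((hmem ((u / f (o k)) • o k)).2 ⟨k, _, by positivity, rfl⟩)
    rw [map_smul, smul_eq_mul, div_mul_cancel₀ _ hcon.ne'] at this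
    exact lt_irrefl _ this
  have := hspan f (hbal f hle)
  rw [this] at hu
  simp only [zero_apply] at hu
  linarith

/-- `V` carries no norm here, so that the norm built from the core does not compete with the one
already present on `A`. -/
theorem exists_linearEquiv_euclideanSpace_of_core {V : Type*} [AddCommGroup V] [Module ℝ V]
    [FiniteDimensional ℝ V] (c : InnerProductSpace.Core ℝ V) (W : Submodule ℝ V) :
    ∃ e : W ≃ₗ[ℝ] EuclideanSpace ℝ (Fin (Module.finrank ℝ W)),
      ∀ v : W, ‖e v‖ ^ 2 = c.inner (v : V) (v : V) := by
  let _ : NormedAddCommGroup V := c.toNormedAddCommGroup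
  let _ : InnerProductSpace ℝ V := InnerProductSpace.ofCore c.toCore
  refine ⟨(stdOrthonormalBasis ℝ W).repr.toLinearEquiv, fun v => ?_⟩
  have h1 : ‖(stdOrthonormalBasis ℝ W).repr.toLinearEquiv v‖ = ‖v‖ :=
    (stdOrthonormalBasis ℝ W).repr.norm_map v
  rw [h1, ← real_inner_self_eq_norm_sq]
  rfl

/-- Euclidean coordinates on an affine hyperplane that are adapted to a compact group fixing a point
of it; the vector `w` gets norm one. -/
theorem exists_invariant_coordinates {K : Type*} [Group K] [TopologicalSpace K]
    [IsTopologicalGroup K] [CompactSpace K] {A : Type*} [NormedAddCommGroup A] [NormedSpace ℝ A]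
    [FiniteDimensional ℝ A] {G : K →* (A ≃L[ℝ] A)} (hG : Continuous fun k => (G k : A →L[ℝ] A))
    (u : A →L[ℝ] ℝ) (hu : ∀ k a, u (G k a) = u a) {μ w : A} (hμ : ∀ k, G k μ = μ) (huμ : u μ = 1)
    (hw : w ≠ 0) (huw : u w = 0) :
    ∃ (D : ℕ) (L : A ≃L[ℝ] ℝ × EuclideanSpace ℝ (Fin D)), (∀ a, (L a).1 = u a) ∧
      L μ = (1, 0) ∧ ‖(L w).2‖ = 1 ∧ ∀ k a, ‖(L (G k a)).2‖ = ‖(L a).2‖ := by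
  obtain ⟨c, hc⟩ := exists_invariant_core hG
  obtain ⟨e, he⟩ := exists_linearEquiv_euclideanSpace_of_core c (LinearMap.ker (u : A →ₗ[ℝ] ℝ))
  -- The projection along `μ`; it commutes with the group because `u` and `μ` are invariant.
  let p : A →ₗ[ℝ] LinearMap.ker (u : A →ₗ[ℝ] ℝ) :=
    ((LinearMap.id : A →ₗ[ℝ] A) - (u : A →ₗ[ℝ] ℝ).smulRight μ).codRestrict _ fun a => by
      simp [huμ]
  have hp : ∀ a, (p a : A) = a - u a • μ := fun a => rfl
  have hpw : p w ≠ 0 := by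
    intro h
    have := congrArg Subtype.val h
    rw [hp, huw] at this
    simp [hw] at this
  have hr : ‖e (p w)‖ ≠ 0 := by simpa using hpw
  let L : A ≃ₗ[ℝ] ℝ × EuclideanSpace ℝ (Fin (Module.finrank ℝ (LinearMap.ker (u : A →ₗ[ℝ] ℝ)))) :=
    LinearEquiv.ofLinearMap
      ((u : A →ₗ[ℝ] ℝ).prod (‖e (p w)‖⁻¹ • e.toLinearMap ∘ₗ p))
      (((LinearMap.id : ℝ →ₗ[ℝ] ℝ).smulRight μ).coprod
        (‖e (p w)‖ • (LinearMap.ker (u : A →ₗ[ℝ] ℝ)).subtype ∘ₗ e.symm.toLinearMap))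
      (by
        have h2 : ∀ v : LinearMap.ker (u : A →ₗ[ℝ] ℝ), u v = 0 := fun v => v.2
        have hp1 : p μ = 0 := Subtype.ext (by simp [hp, huμ])
        have hp2 : ∀ v : LinearMap.ker (u : A →ₗ[ℝ] ℝ), p v = v := fun v =>
          Subtype.ext (by simp [hp, h2])
        refine LinearMap.ext fun x => Prod.ext ?_ ?_
        · simp [huμ, h2]
        · simp [hp1, hp2, smul_smul, hr])
      (by
        refine LinearMap.ext fun a => ?_
        simp [smul_smul, hr, hp])
  have hL : ∀ a, L a = (u a, ‖e (p w)‖⁻¹ • e (p a)) := fun a => rfl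
  refine ⟨_, L.toContinuousLinearEquiv, fun a => by simp [hL], ?_, ?_, fun k a => ?_⟩
  · have hp1 : p μ = 0 := Subtype.ext (by simp [hp, huμ])
    simp [hL, hp1, huμ]
  · simp only [LinearEquiv.coe_toContinuousLinearEquiv', hL, norm_smul, norm_inv, norm_norm]
    exact inv_mul_cancel₀ hr
  · have : ‖e (p (G k a))‖ = ‖e (p a)‖ := by
      rw [← sq_eq_sq₀ (norm_nonneg _) (norm_nonneg _), he, he, ← hc k (p a)]
      have : (p (G k a) : A) = G k (p a) := by simp [hp, hu, hμ]
      rw [this]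
    simp only [LinearEquiv.coe_toContinuousLinearEquiv', hL, norm_smul, this]

/-! ### Commutative groups transitive on directions -/

section Commutative

variable {K : Type*} [Group K] {E : Type*} [NormedAddCommGroup E] [InnerProductSpace ℝ E]
  [FiniteDimensional ℝ E] {ρ : K →* Module.End ℝ E} {v : E}

/-- For isometries the inverse is the adjoint, so `ρ R + ρ R⁻¹` is symmetric and has an eigenvector.
By transitivity that is a multiple of some `ρ k v`, and commutativity carries the eigenvalue
equation back to `v`. -/
theorem exists_add_inv_eq_smul (hcomm : ∀ k l : K, k * l = l * k) (hρ : ∀ k x, ‖ρ k x‖ = ‖x‖)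
    (hv : v ≠ 0) (htrans : ∀ x, ∃ k, ∃ s : ℝ, x = s • ρ k v) (R : K) :
    ∃ c : ℝ, ρ R v + ρ R⁻¹ v = c • v := by
  have hmul : ∀ k l x, ρ k (ρ l x) = ρ (k * l) x := fun k l x => by rw [map_mul]; rfl
  have hone : ∀ x, ρ 1 x = x := fun x => by rw [map_one]; rfl
  have hinner : ∀ k x y, inner ℝ (ρ k x) y = inner ℝ x (ρ k⁻¹ y) := by
    intro k x y
    have h := (LinearMap.norm_map_iff_inner_map_map (ρ k)).1 (hρ k) x (ρ k⁻¹ y)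
    rwa [hmul, mul_inv_cancel, hone] at h
  have : Nontrivial E := ⟨⟨v, 0, hv⟩⟩
  have hsymm : (ρ R + ρ R⁻¹).IsSymmetric := by
    intro x y
    simp only [LinearMap.add_apply, inner_add_left, inner_add_right, hinner, inv_inv]
    ring
  obtain ⟨e, he⟩ := hsymm.hasEigenvalue_iSup_of_finiteDimensional.exists_hasEigenvector
  obtain ⟨k, s, rfl⟩ := htrans e
  have hs : s ≠ 0 := by
    rintro rfl
    exact he.2 (zero_smul _ _)
  have h := he.apply_eq_smul
  generalize (⨆ x : { x : E // x ≠ 0 }, RCLike.re (inner ℝ ((ρ R + ρ R⁻¹) ↑x) ↑x) / ‖(x : E)‖ ^ 2)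
    = c at h
  refine ⟨c, ?_⟩
  have h' := congrArg (fun y => ρ k⁻¹ (s⁻¹ • y)) h
  simp only [LinearMap.add_apply, map_smul, map_add, smul_smul, smul_add, hmul,
    hcomm R k, hcomm R⁻¹ k, inv_mul_cancel_left, inv_mul_cancel, inv_mul_cancel₀ hs, hone,
    one_smul] at h'
  rw [h']
  congr 1
  simp [mul_comm, hs]

/-- A commutative group of isometries that is transitive on directions and contains a complex
structure acts on a plane. -/
theorem finrank_eq_two_of_commutative (hcomm : ∀ k l : K, k * l = l * k)
    (hρ : ∀ k x, ‖ρ k x‖ = ‖x‖) (hv : v ≠ 0) (htrans : ∀ x, ∃ k, ∃ s : ℝ, x = s • ρ k v)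
    {J : K} (hJ : ∀ x, ρ J (ρ J x) = -x) : Module.finrank ℝ E = 2 := by
  have hmul : ∀ k l x, ρ k (ρ l x) = ρ (k * l) x := fun k l x => by rw [map_mul]; rfl
  have hone : ∀ x, ρ 1 x = x := fun x => by rw [map_one]; rfl
  have hJinv : ∀ x, ρ J⁻¹ x = -ρ J x := by
    intro x
    have := hJ (ρ J⁻¹ x)
    rw [hmul J J⁻¹, mul_inv_cancel, hone] at this
    exact neg_eq_iff_eq_neg.1 this.symm
  -- The previous lemma gives `ρ R v + ρ R⁻¹ v = a • v`; for `J * R`, after applying `ρ J`, it gives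
  -- `-ρ R v + ρ R⁻¹ v = b • ρ J v`. Subtracting isolates `ρ R v`.
  have hspan : ∀ R, ρ R v ∈ Submodule.span ℝ (range ![v, ρ J v]) := by
    intro R
    obtain ⟨a, ha⟩ := exists_add_inv_eq_smul hcomm hρ hv htrans R
    obtain ⟨b, hb⟩ := exists_add_inv_eq_smul hcomm hρ hv htrans (J * R)
    have hb := congrArg (ρ J) hb
    rw [map_add, mul_inv_rev, hcomm R⁻¹, ← hmul J R, ← hmul J⁻¹, hJ, map_smul, hJinv, map_neg,
      hJ, neg_neg] at hb
    have : ρ R v = (a / 2) • v - (b / 2) • ρ J v := by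
      have h1 : (2 : ℝ) • ρ R v = a • v - b • ρ J v := by
        rw [← ha, ← hb]
        module
      rw [← inv_smul_smul₀ (two_ne_zero (α := ℝ)) (ρ R v), h1]
      module
    rw [this]
    exact sub_mem (Submodule.smul_mem _ _ (Submodule.subset_span ⟨0, rfl⟩))
      (Submodule.smul_mem _ _ (Submodule.subset_span ⟨1, rfl⟩))
  have htop : Submodule.span ℝ (range ![v, ρ J v]) = ⊤ := by
    refine eq_top_iff.2 fun x _ => ?_
    obtain ⟨k, s, rfl⟩ := htrans x
    exact Submodule.smul_mem _ _ (hspan k)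
  have hli : LinearIndependent ℝ ![v, ρ J v] := by
    refine LinearIndependent.pair_iff.2 fun s t hst => ?_
    have h2 := congrArg (ρ J) hst
    rw [map_add, map_smul, map_smul, hJ, map_zero] at h2
    have h3 : (s ^ 2 + t ^ 2) • v = 0 := by
      have : (s ^ 2 + t ^ 2) • v = s • (s • v + t • ρ J v) - t • (s • ρ J v + t • -v) := by module
      rw [this, hst, h2]
      simp
    have h4 : s ^ 2 + t ^ 2 = 0 := (smul_eq_zero.1 h3).resolve_right hv
    constructor <;> nlinarith [sq_nonneg s, sq_nonneg t]
  rw [← finrank_top ℝ E, ← htop, finrank_span_eq_card hli]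
  rfl

end Commutative

/-! ### Half turns and plane rotations -/

section Rotations

/-- The rotation by `π` in the plane of the `i`-th and `j`-th axes. -/
def halfTurn {d : ℕ} (i j : Fin d) : SOd d :=
  ⟨Matrix.diagonal (Function.update (1 : Fin d → ℝ) i (-1) *
      Function.update (1 : Fin d → ℝ) j (-1)), by
    rw [Matrix.mem_specialOrthogonalGroup_iff, Matrix.mem_orthogonalGroup_iff]
    constructor
    · rw [Matrix.diagonal_transpose, Matrix.diagonal_mul_diagonal, ← Matrix.diagonal_one]
      congr 1
      funext k
      simp only [Pi.mul_apply, Function.update_apply, Pi.one_apply]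
      split_ifs <;> norm_num
    · rw [Matrix.det_diagonal]
      simp only [Pi.mul_apply, Finset.prod_mul_distrib]
      rw [Finset.prod_update_of_mem (Finset.mem_univ _),
        Finset.prod_update_of_mem (Finset.mem_univ _)]
      simp⟩

theorem halfTurn_mul_self {d : ℕ} (i j : Fin d) : halfTurn i j * halfTurn i j = 1 := by
  refine Subtype.ext ?_
  change Matrix.diagonal _ * Matrix.diagonal _ = 1
  rw [Matrix.diagonal_mul_diagonal, ← Matrix.diagonal_one]
  congr 1
  funext k
  simp only [Pi.mul_apply, Function.update_apply, Pi.one_apply]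
  split_ifs <;> norm_num

theorem halfTurn_apply_self {d : ℕ} (i j k : Fin d) :
    (halfTurn i j : Matrix (Fin d) (Fin d) ℝ) k k =
      (if k = i then -1 else 1) * (if k = j then -1 else 1) := by
  simp [halfTurn, Function.update_apply]

theorem halfTurn_ne_one {d : ℕ} {i j : Fin d} (h : i ≠ j) : halfTurn i j ≠ 1 := by
  intro h1
  have := congrArg (fun R : SOd d => (R : Matrix (Fin d) (Fin d) ℝ) i i) h1
  simp only [halfTurn_apply_self, if_pos, if_neg h] at this
  norm_num at this

theorem halfTurn_ne_halfTurn {d : ℕ} {i j k : Fin d} (hij : i ≠ j) (hjk : j ≠ k) :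
    halfTurn i j ≠ halfTurn i k := by
  intro h1
  have := congrArg (fun R : SOd d => (R : Matrix (Fin d) (Fin d) ℝ) j j) h1
  simp only [halfTurn_apply_self, if_pos, if_neg hjk, if_neg hij.symm] at this
  norm_num at this

theorem nontrivial_SOd {d : ℕ} (hd : 2 ≤ d) : Nontrivial (SOd d) :=
  ⟨⟨halfTurn ⟨0, by omega⟩ ⟨1, by omega⟩, 1, halfTurn_ne_one (by simp [Fin.ext_iff])⟩⟩

/-- The rotation of the plane with first column `(a, b)`. -/
def planeRotation (a b : ℝ) (h : a ^ 2 + b ^ 2 = 1) : SOd 2 :=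
  ⟨!![a, -b; b, a], by
    rw [Matrix.of_mem_specialOrthogonalGroup_fin_two_iff]
    exact ⟨rfl, rfl, by rw [neg_sq, h]⟩⟩

theorem exists_eq_planeRotation (R : SOd 2) : ∃ a b h, R = planeRotation a b h := by
  obtain ⟨h1, h2, h3⟩ := Matrix.mem_specialOrthogonalGroup_fin_two_iff.1 R.2
  refine ⟨(R : Matrix (Fin 2) (Fin 2) ℝ) 0 0, (R : Matrix (Fin 2) (Fin 2) ℝ) 1 0, ?_, ?_⟩
  · rw [h2] at h3
    linarith [h3, neg_sq ((R : Matrix (Fin 2) (Fin 2) ℝ) 1 0)]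
  · refine Subtype.ext ?_
    change (R : Matrix (Fin 2) (Fin 2) ℝ) = !![_, _; _, _]
    rw [← h2]
    conv_lhs => rw [Matrix.eta_fin_two (R : Matrix (Fin 2) (Fin 2) ℝ), ← h1]

theorem mul_comm_SOd_two (R S : SOd 2) : R * S = S * R := by
  obtain ⟨a, b, h, rfl⟩ := exists_eq_planeRotation R
  obtain ⟨a', b', h', rfl⟩ := exists_eq_planeRotation S
  refine Subtype.ext ?_
  change !![a, -b; b, a] * !![a', -b'; b', a'] = !![a', -b'; b', a'] * !![a, -b; b, a]
  rw [Matrix.mul_fin_two, Matrix.mul_fin_two]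
  ring_nf

/-- The rotation of the plane by `π / 2`. -/
def quarterTurn : SOd 2 := planeRotation 0 1 (by norm_num)

theorem coe_quarterTurn_mul_self :
    ((quarterTurn * quarterTurn : SOd 2) : Matrix (Fin 2) (Fin 2) ℝ) = -1 := by
  change !![(0 : ℝ), -1; 1, 0] * !![0, -1; 1, 0] = -1
  rw [Matrix.mul_fin_two, Matrix.one_fin_two]
  ext i j
  fin_cases i <;> fin_cases j <;> simp

/-- The rotation of the plane by `π`. -/
def planeNeg : SOd 2 := quarterTurn * quarterTurn

theorem coe_planeNeg : (planeNeg : Matrix (Fin 2) (Fin 2) ℝ) = -1 := coe_quarterTurn_mul_self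

theorem planeNeg_mul_self : planeNeg * planeNeg = 1 := by
  refine Subtype.ext ?_
  change (planeNeg : Matrix (Fin 2) (Fin 2) ℝ) * planeNeg = 1
  rw [coe_planeNeg]
  simp

theorem planeNeg_ne_one : planeNeg ≠ 1 := by
  intro h
  have := congrArg (fun R : SOd 2 => (R : Matrix (Fin 2) (Fin 2) ℝ) 0 0) h
  simp only [coe_planeNeg] at this
  norm_num at this

theorem planeNeg_inv : planeNeg⁻¹ = planeNeg := inv_eq_of_mul_eq_one_left planeNeg_mul_self

end Rotations

/-! ### Bloch coordinates and the two dimensions -/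

namespace RotationStateSpace

variable {d : ℕ} {A : Type*} [NormedAddCommGroup A] [NormedSpace ℝ A] [FiniteDimensional ℝ A]

theorem map_mem_states (S : RotationStateSpace d A) (R : SOd d) {ω : A} (hω : ω ∈ S.states) :
    S.G R ω ∈ S.states :=
  S.toDynamicalStateSpace.map_mem_states (S.G_mem R) hω

theorem unit_map (S : RotationStateSpace d A) (R : SOd d) (a : A) : S.unit (S.G R a) = S.unit a :=
  S.toDynamicalStateSpace.unit_map (S.G_mem R) a

/-- Invariant Euclidean coordinates around `μ`, scaled so that `w` has norm one. -/
structure IsBloch (S : RotationStateSpace d A) {D : ℕ} (μ w : A)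
    (L : A ≃L[ℝ] ℝ × EuclideanSpace ℝ (Fin D)) : Prop where
  fst : ∀ a, (L a).1 = S.unit a
  map_centre : L μ = (1, 0)
  norm_map : ‖(L w).2‖ = 1
  norm_rep : ∀ R a, ‖(L (S.G R a)).2‖ = ‖(L a).2‖

variable {S : RotationStateSpace d A} {F : A →L[ℝ] ℝ} {μ w : A}

theorem exists_isRadial (hd : 2 ≤ d) (hex : ∃ ω, IsPeak S.states S.G F 1 ω)
    (hinj : ∀ ω ω', IsPeak S.states S.G F 1 ω → IsPeak S.states S.G F 1 ω' → F ω = F ω' → ω = ω') :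
    ∃ μ w, IsRadial S.states S.G F μ w :=
  have := nontrivial_SOd hd
  _root_.exists_isRadial S.G_continuous S.isCompact_states S.convex_states
    (fun R _ => S.map_mem_states R) hex hinj

theorem unit_of_isRadial (h : IsRadial S.states S.G F μ w) : S.unit w = 0 := by
  have h1 := h.isPeak.1.2
  rw [map_add, h.mem.2] at h1
  linarith

theorem exists_isBloch (hd : 2 ≤ d) (h : IsRadial S.states S.G F μ w) :
    ∃ (D : ℕ) (L : A ≃L[ℝ] ℝ × EuclideanSpace ℝ (Fin D)), S.IsBloch μ w L := by
  have hw : w ≠ 0 := by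
    rintro rfl
    have := nontrivial_SOd hd
    obtain ⟨Y, hY⟩ := exists_ne (1 : SOd d)
    simpa using h.map_lt hY
  obtain ⟨D, L, h1, h2, h3, h4⟩ := exists_invariant_coordinates S.G_continuous S.unit S.unit_map
    h.fixed h.mem.2 hw (unit_of_isRadial h)
  exact ⟨D, L, h1, h2, h3, h4⟩

section Bloch

variable {D : ℕ} {L : A ≃L[ℝ] ℝ × EuclideanSpace ℝ (Fin D)}

/-- The star-shaped hull of the orbit is a linear image of the convex state set, and it spans
because the states do. -/
theorem range_bloch (h : IsRadial S.states S.G F μ w) (hL : S.IsBloch μ w L) :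
    range (fun Y => (L (S.G Y w)).2) = Metric.sphere 0 1 := by
  have hsnd : ∀ (t : ℝ) (Y : SOd d), (L (μ + t • S.G Y w)).2 = t • (L (S.G Y w)).2 := by
    intro t Y
    simp [hL.map_centre]
  refine range_eq_sphere_of_convex ?_ (fun Y => by rw [hL.norm_rep, hL.norm_map]) ?_ ?_ ?_
  · exact continuous_snd.comp (L.continuous.comp (continuous_rep_apply S.G_continuous w))
  · have : {x | ∃ k, ∃ t ∈ Icc (0 : ℝ) 1, x = t • (L (S.G k w)).2} =
        (LinearMap.snd ℝ ℝ (EuclideanSpace ℝ (Fin D)) ∘ₗ (L : A →ₗ[ℝ] _)) '' S.states := by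
      ext x
      constructor
      · rintro ⟨Y, t, ht, rfl⟩
        exact ⟨_, h.mem_of_mem_Icc Y ht, hsnd t Y⟩
      · rintro ⟨φ, hφ, rfl⟩
        obtain ⟨Y, t, ht, rfl⟩ := h.exists_eq S.G_continuous hφ
        exact ⟨Y, t, ht, hsnd t Y⟩
    rw [this]
    exact S.convex_states.linear_image _
  · intro f hf
    have h0 := S.eq_zero_of_forall_states
      ((f : _ →ₗ[ℝ] ℝ) ∘ₗ LinearMap.snd ℝ ℝ (EuclideanSpace ℝ (Fin D)) ∘ₗ (L : A →ₗ[ℝ] _)) (by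
        intro φ hφ
        obtain ⟨Y, t, ht, rfl⟩ := h.exists_eq S.G_continuous hφ
        change f (L (μ + t • S.G Y w)).2 = 0
        rw [hsnd, map_smul, hf, smul_zero])
    ext x
    have := LinearMap.congr_fun h0 (L.symm (0, x))
    simpa using this
  · intro f hf
    exact h.balanced (f.comp ((ContinuousLinearMap.snd ℝ ℝ (EuclideanSpace ℝ (Fin D))).comp
      (L : A →L[ℝ] ℝ × EuclideanSpace ℝ (Fin D)))) hf

theorem exists_eq_smul (h : IsRadial S.states S.G F μ w) (hL : S.IsBloch μ w L) {a : A}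
    (ha : S.unit a = 0) : ∃ Y, a = ‖(L a).2‖ • S.G Y w := by
  rcases eq_or_ne ‖(L a).2‖ 0 with h0 | h0
  · refine ⟨1, ?_⟩
    rw [h0, zero_smul]
    refine L.injective ?_
    rw [map_zero]
    exact Prod.ext ((hL.fst a).trans ha) (norm_eq_zero.1 h0)
  · have : ‖(L a).2‖⁻¹ • (L a).2 ∈ Metric.sphere (0 : EuclideanSpace ℝ (Fin D)) 1 := by
      simp [norm_smul, h0]
    rw [← range_bloch h hL] at this
    obtain ⟨Y, hY⟩ := this
    refine ⟨Y, L.injective (Prod.ext ?_ ?_)⟩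
    · rw [hL.fst, hL.fst, map_smul, unit_map, unit_of_isRadial h, ha, smul_zero]
    · rw [map_smul, Prod.smul_snd, show (L (S.G Y w)).2 = _ from hY, smul_inv_smul₀ h0]

/-- The vector `S.G Z a + a` is fixed by `Z` and is a multiple of some `S.G Y w`. If it were
nonzero, `Z * Y = Y` by freeness of the orbit. -/
theorem map_eq_neg_of_involution (h : IsRadial S.states S.G F μ w) (hL : S.IsBloch μ w L)
    {Z : SOd d} (hZ : Z * Z = 1) (hZ1 : Z ≠ 1) {a : A} (ha : S.unit a = 0) : S.G Z a = -a := by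
  obtain ⟨Y, hY⟩ := exists_eq_smul h hL (a := S.G Z a + a) (by rw [map_add, unit_map, ha, add_zero])
  generalize ‖(L (S.G Z a + a)).2‖ = s at hY
  rcases eq_or_ne s 0 with h0 | h0
  · rw [h0, zero_smul] at hY
    exact eq_neg_of_add_eq_zero_left hY
  · exfalso
    have h1 := congrArg (S.G Z) hY
    rw [map_add, ← rep_mul_apply, hZ, rep_one_apply, add_comm, hY, map_smul, ← rep_mul_apply] at h1
    have h2 := h.injective (smul_right_injective A h0 h1)
    exact hZ1 (by simpa using h2.symm)

/-- With three axes there are two different half turns; both send `w` to `-w`, against injectivity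
of the orbit map. -/
theorem two_of_isRadial (hd : 2 ≤ d) (h : IsRadial S.states S.G F μ w) (hL : S.IsBloch μ w L) :
    d = 2 := by
  by_contra hne
  have h3 : 3 ≤ d := by omega
  have h01 : (⟨0, by omega⟩ : Fin d) ≠ ⟨1, by omega⟩ := by simp [Fin.ext_iff]
  have h02 : (⟨0, by omega⟩ : Fin d) ≠ ⟨2, by omega⟩ := by simp [Fin.ext_iff]
  have h12 : (⟨1, by omega⟩ : Fin d) ≠ ⟨2, by omega⟩ := by simp [Fin.ext_iff]
  have h1 := map_eq_neg_of_involution h hL (halfTurn_mul_self _ _) (halfTurn_ne_one h01)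
    (unit_of_isRadial h)
  have h2 := map_eq_neg_of_involution h hL (halfTurn_mul_self _ _) (halfTurn_ne_one h02)
    (unit_of_isRadial h)
  exact halfTurn_ne_halfTurn h01 h12 (h.injective (h1.trans h2.symm))

end Bloch

/-- The action on the kernel of the unit, read in coordinates, is commutative and isometric, reaches
every direction, and has the quarter turn as complex structure. -/
theorem dim_eq_two {S : RotationStateSpace 2 A} {D : ℕ}
    {L : A ≃L[ℝ] ℝ × EuclideanSpace ℝ (Fin D)} (h : IsRadial S.states S.G F μ w)
    (hL : S.IsBloch μ w L) : D = 2 := by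
  have hunit : ∀ x : EuclideanSpace ℝ (Fin D), S.unit (L.symm (0, x)) = 0 := fun x => by
    rw [← hL.fst]
    simp
  have hsymm : ∀ a, S.unit a = 0 → L.symm (0, (L a).2) = a := fun a ha => by
    rw [← ha, ← hL.fst]
    exact L.symm_apply_apply a
  let ρ : SOd 2 →* Module.End ℝ (EuclideanSpace ℝ (Fin D)) :=
    { toFun := fun R => LinearMap.snd ℝ ℝ (EuclideanSpace ℝ (Fin D)) ∘ₗ (L : A →ₗ[ℝ] _) ∘ₗ
        ((S.G R : A →L[ℝ] A) : A →ₗ[ℝ] A) ∘ₗ (L.symm : _ →ₗ[ℝ] A) ∘ₗ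
        LinearMap.inr ℝ ℝ (EuclideanSpace ℝ (Fin D))
      map_one' := by
        ext1 x
        simp
      map_mul' := fun R T => by
        refine LinearMap.ext fun x => ?_
        change (L (S.G (R * T) (L.symm (0, x)))).2 =
          (L (S.G R (L.symm (0, (L (S.G T (L.symm (0, x)))).2)))).2
        rw [hsymm _ (by rw [unit_map, hunit]), rep_mul_apply] }
  have hρ : ∀ R x, ρ R x = (L (S.G R (L.symm (0, x)))).2 := fun R x => rfl
  have hw := hsymm w (unit_of_isRadial h)
  have := finrank_eq_two_of_commutative (ρ := ρ) (v := (L w).2) (J := quarterTurn) mul_comm_SOd_two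
    (fun R x => by rw [hρ, hL.norm_rep]; simp)
    (by rw [← norm_ne_zero_iff, hL.norm_map]; exact one_ne_zero)
    (fun x => by
      obtain ⟨Y, hY⟩ := exists_eq_smul h hL (hunit x)
      refine ⟨Y, ‖(L (L.symm (0, x))).2‖, ?_⟩
      rw [hρ, hw]
      have := congrArg (fun a => (L a).2) hY
      simpa using this)
    (fun x => by
      rw [hρ, hρ, hsymm _ (by rw [unit_map, hunit]), ← rep_mul_apply,
        show quarterTurn * quarterTurn = planeNeg from rfl,
        map_eq_neg_of_involution h hL planeNeg_mul_self planeNeg_ne_one (hunit x)]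
      simp)
  simpa using this

end RotationStateSpace

/-! ### Transport of structure along a linear bijection -/

section Transport

variable {A B : Type*} [NormedAddCommGroup A] [NormedSpace ℝ A] [FiniteDimensional ℝ A]
  [NormedAddCommGroup B] [NormedSpace ℝ B] [FiniteDimensional ℝ B]

/-- Precomposition with the inverse of `L`, as an equivalence of dual spaces. -/
def dualCongr (L : A ≃L[ℝ] B) : (A →L[ℝ] ℝ) ≃L[ℝ] (B →L[ℝ] ℝ) :=
  L.arrowCongr (ContinuousLinearEquiv.refl ℝ ℝ)

omit [FiniteDimensional ℝ A] [FiniteDimensional ℝ B] in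
theorem dualCongr_apply (L : A ≃L[ℝ] B) (M : A →L[ℝ] ℝ) (b : B) :
    dualCongr L M b = M (L.symm b) := rfl

/-- The transport of a state space along a linear bijection. -/
def StateSpace.map (S : StateSpace A) (L : A ≃L[ℝ] B) : StateSpace B where
  cone := S.cone.comap (L.symm : B →ₗ[ℝ] A)
  cone_closed := S.cone_closed.preimage L.symm.continuous
  cone_full := by
    refine eq_top_iff.2 fun b _ => ?_
    have h : L.symm b ∈ Submodule.span ℝ (S.cone : Set A) := by
      rw [S.cone_full]
      trivial
    have h1 := Submodule.mem_map_of_mem (f := (L : A →ₗ[ℝ] B)) h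
    rw [Submodule.map_span] at h1
    refine Submodule.span_mono ?_ (by simpa using h1)
    rintro _ ⟨a, ha, rfl⟩
    simpa using ha
  cone_salient := fun x hx hx' => by
    have := S.cone_salient (L.symm x) hx (by simpa using hx')
    simpa using this
  unit := dualCongr L S.unit
  unit_pos := fun x hx h0 => S.unit_pos (L.symm x) hx (by simpa using h0)
  effects := dualCongr L '' S.effects
  effects_closed := (dualCongr L).isClosed_image.2 S.effects_closed
  effects_convex := S.effects_convex.linear_image (dualCongr L : (A →L[ℝ] ℝ) →ₗ[ℝ] (B →L[ℝ] ℝ))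
  effects_full :=
    ((dualCongr L).toLinearEquiv.toAffineEquiv.span_eq_top_iff).1 S.effects_full
  unit_mem_effects := ⟨_, S.unit_mem_effects, rfl⟩
  effects_nonneg := by
    rintro _ ⟨M, hM, rfl⟩ x hx
    exact S.effects_nonneg M hM _ hx
  effects_le_unit := by
    rintro _ ⟨M, hM, rfl⟩ x hx
    exact S.effects_le_unit M hM _ hx

theorem StateSpace.states_map (S : StateSpace A) (L : A ≃L[ℝ] B) :
    (S.map L).states = L '' S.states := by
  ext b
  constructor
  · rintro ⟨h1, h2⟩
    exact ⟨L.symm b, ⟨h1, h2⟩, by simp⟩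
  · rintro ⟨a, ⟨h1, h2⟩, rfl⟩
    exact ⟨by simpa [StateSpace.map] using h1, by simpa [StateSpace.map, dualCongr_apply] using h2⟩

/-- The transport of a dynamical state space along a linear bijection. -/
def DynamicalStateSpace.map (S : DynamicalStateSpace A) (L : A ≃L[ℝ] B) :
    DynamicalStateSpace B where
  toStateSpace := S.toStateSpace.map L
  transf :=
    { carrier := {h | (L.trans h).trans L.symm ∈ S.transf}
      mul_mem' := fun {g h} hg hh => by
        have : (L.trans (g * h)).trans L.symm =
            (L.trans g).trans L.symm * (L.trans h).trans L.symm := by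
          ext a
          change L.symm (g (h (L a))) = L.symm (g (L (L.symm (h (L a)))))
          rw [L.apply_symm_apply]
        rw [mem_ofPred_eq, this]
        exact S.transf.mul_mem hg hh
      one_mem' := by
        have : (L.trans (1 : B ≃L[ℝ] B)).trans L.symm = 1 := by
          ext a
          exact L.symm_apply_apply a
        change (L.trans (1 : B ≃L[ℝ] B)).trans L.symm ∈ S.transf
        rw [this]
        exact S.transf.one_mem
      inv_mem' := fun {g} hg => by
        have : (L.trans g⁻¹).trans L.symm = ((L.trans g).trans L.symm)⁻¹ := by
          rw [eq_inv_iff_mul_eq_one]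
          ext a
          change L.symm (g.symm (L (L.symm (g (L a))))) = a
          simp
        change (L.trans g⁻¹).trans L.symm ∈ S.transf
        rw [this]
        exact S.transf.inv_mem hg }
  transf_compact := by
    have hc : Continuous fun T : A →L[ℝ] A =>
        ((L : A →L[ℝ] B).comp T).comp (L.symm : B →L[ℝ] A) :=
      (continuous_const.clm_comp continuous_id).clm_comp continuous_const
    convert S.transf_compact.image hc using 1
    ext T
    constructor
    · rintro ⟨g, hg, rfl⟩
      refine ⟨_, ⟨_, hg, rfl⟩, ?_⟩
      ext b
      simp
    · rintro ⟨_, ⟨g, hg, rfl⟩, rfl⟩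
      refine ⟨(L.symm.trans g).trans L, ?_, rfl⟩
      change (L.trans ((L.symm.trans g).trans L)).trans L.symm ∈ S.transf
      rwa [show (L.trans ((L.symm.trans g).trans L)).trans L.symm = g by ext a; simp]
  transf_states := fun g hg => by
    rw [StateSpace.states_map]
    conv_rhs => rw [← S.transf_states _ hg]
    simp only [image_image]
    refine image_congr fun a _ => ?_
    simp
  transf_effects := fun g hg => by
    change (fun M : B →L[ℝ] ℝ => M.comp (g : B →L[ℝ] B)) '' (dualCongr L '' S.effects) =
      dualCongr L '' S.effects
    conv_rhs => rw [← S.transf_effects _ hg]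
    simp only [image_image]
    refine image_congr fun M _ => ?_
    ext b
    simp [dualCongr_apply]

theorem DynamicalStateSpace.isDynamicalEquiv_map (S : DynamicalStateSpace A) (L : A ≃L[ℝ] B) :
    IsDynamicalEquiv S (S.map L) L where
  map_cone := by
    ext b
    constructor
    · rintro ⟨a, ha, rfl⟩
      change L.symm (L a) ∈ S.cone
      simpa using ha
    · intro hb
      exact ⟨L.symm b, hb, by simp⟩
  unit_comp := by
    ext a
    change S.unit (L.symm (L a)) = _
    simp
  effects_comp := by
    change (fun M : B →L[ℝ] ℝ => M.comp (L : A →L[ℝ] B)) '' (dualCongr L '' S.effects) = S.effects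
    rw [image_image]
    convert image_id S.effects using 1
    refine image_congr fun M _ => ?_
    ext a
    simp [dualCongr_apply]
  transf_conj := by
    ext h
    constructor
    · rintro ⟨g, hg, rfl⟩
      change (L.trans ((L.symm.trans g).trans L)).trans L.symm ∈ S.transf
      rwa [show (L.trans ((L.symm.trans g).trans L)).trans L.symm = g by ext a; simp]
    · intro hh
      refine ⟨(L.trans h).trans L.symm, hh, ?_⟩
      ext b
      simp

end Transport

/-! ### The structure theorem for frame bits -/

namespace RotationStateSpace

variable {d : ℕ} {A : Type*} [NormedAddCommGroup A] [NormedSpace ℝ A] [FiniteDimensional ℝ A]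
  {S : RotationStateSpace d A} {F : A →L[ℝ] ℝ} {μ w : A}

theorem isCodeword_iff_isPeak {X : SOd d} {ω : A} :
    S.IsCodeword X ω ↔ IsPeak S.states S.G S.M X ω := Iff.rfl

/-- Noise strictly lowers the maximum of a codeword. -/
theorem IsNoisier.frameEffect_lt {Y : SOd d} {ω ω' : A} (h : S.IsNoisier ω' ω)
    (hω : S.IsCodeword Y ω) : S.frameEffect Y ω' < S.frameEffect Y ω := by
  obtain ⟨n, lam, R, hlam, hsum, hR, heq⟩ := h
  -- If all `R j` were `1`, distinctness would leave a single term of weight `1`, but each weight is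
  -- less than `1`.
  obtain ⟨j, hj⟩ : ∃ j, R j ≠ 1 := by
    by_contra! hcon
    have : Subsingleton (Fin n) := ⟨fun i j => hR ((hcon i).trans (hcon j).symm)⟩
    rcases isEmpty_or_nonempty (Fin n) with hn | ⟨⟨i⟩⟩
    · simp at hsum
    · rw [Fintype.sum_subsingleton _ i] at hsum
      exact (hlam i).2.ne hsum
  have hlt : ∀ i, R i ≠ 1 → lam i * S.frameEffect (R i * Y) ω < lam i * S.frameEffect Y ω :=
    fun i hi => mul_lt_mul_of_pos_left (hω.2 _ (by simpa using hi)) (hlam i).1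
  calc S.frameEffect Y ω' = ∑ i, lam i * S.frameEffect (R i * Y) ω := heq Y
    _ < ∑ i, lam i * S.frameEffect Y ω := by
      refine Finset.sum_lt_sum (fun i _ => ?_) ⟨j, Finset.mem_univ _, hlt j hj⟩
      by_cases hi : R i = 1
      · rw [hi, one_mul]
      · exact (hlt i hi).le
    _ = S.frameEffect Y ω := by rw [← Finset.sum_mul, hsum, one_mul]

theorem IsFrameBit.exists_isRadial (h : S.IsFrameBit) (hd : 2 ≤ d) :
    ∃ μ w, IsRadial S.states S.G S.M μ w := by
  refine RotationStateSpace.exists_isRadial hd h.exists_codeword fun ω ω' hω hω' he => ?_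
  have he' : S.frameEffect 1 ω = S.frameEffect 1 ω' := by
    simpa [frameEffect, rep_one_apply] using he
  by_contra hne
  rcases h.noisier ω ω' hne 1 hω hω' with h1 | h1
  · exact (h1.frameEffect_lt hω).ne he'.symm
  · exact (h1.frameEffect_lt hω').ne he'

theorem frameEffect_radial (h : IsRadial S.states S.G F μ w) (X Y : SOd d) (t : ℝ) :
    S.frameEffect Y (μ + t • S.G X w) = S.M μ + t * S.M (S.G (Y⁻¹ * X) w) := by
  change S.M (S.G Y⁻¹ (μ + t • S.G X w)) = _
  rw [map_add, map_smul, h.fixed, ← rep_mul_apply, map_add, map_smul, smul_eq_mul]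

theorem continuous_visibility (S : RotationStateSpace d A) (X : SOd d) (a : A) :
    Continuous fun Y : SOd d => S.M (S.G (Y⁻¹ * X) a) :=
  S.M.continuous.comp ((continuous_rep_apply S.G_continuous a).comp
    (continuous_inv.mul continuous_const))

theorem spread_radial (h : IsRadial S.states S.G F μ w) (X : SOd d) {t : ℝ} (ht : 0 ≤ t) :
    S.spread (μ + t • S.G X w) =
      t * ((⨆ Y : SOd d, S.M (S.G (Y⁻¹ * X) w)) - ⨅ Y : SOd d, S.M (S.G (Y⁻¹ * X) w)) := by
  have hcont : Continuous fun Y : SOd d => t * S.M (S.G (Y⁻¹ * X) w) :=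
    continuous_const.mul (continuous_visibility S X w)
  have hc := isCompact_range hcont
  simp only [spread, frameEffect_radial h]
  rw [← add_ciSup hc.bddAbove, ← add_ciInf hc.bddBelow, ← Real.mul_iSup_of_nonneg ht,
    ← Real.mul_iInf_of_nonneg ht]
  ring

/-- The codewords for `X` are `μ + t • S.G X w` with `0 < t ≤ 1`, and their spread is `t` times a
positive constant, so the maximum is at `t = 1`. -/
theorem isMaximalCodeword_iff (hd : 2 ≤ d) (h : IsRadial S.states S.G S.M μ w) {X : SOd d}
    {φ : A} : S.IsMaximalCodeword X φ ↔ φ = μ + S.G X w := by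
  have := nontrivial_SOd hd
  have hpos : 0 < (⨆ Y : SOd d, S.M (S.G (Y⁻¹ * X) w)) - ⨅ Y : SOd d, S.M (S.G (Y⁻¹ * X) w) := by
    have hc := isCompact_range (continuous_visibility S X w)
    obtain ⟨Y, hY⟩ := exists_ne X
    have h1 := le_ciSup hc.bddAbove X
    have h2 := ciInf_le hc.bddBelow Y
    have h3 := h.map_lt (Y := Y⁻¹ * X) (by rwa [Ne, inv_mul_eq_one])
    simp only [inv_mul_cancel, rep_one_apply] at h1
    linarith
  have hpeak : S.IsCodeword X (μ + (1 : ℝ) • S.G X w) :=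
    isCodeword_iff_isPeak.2 (h.isPeak_iff.2 ⟨1, ⟨one_pos, le_rfl⟩, rfl⟩)
  constructor
  · rintro ⟨hφ, hmax⟩
    obtain ⟨t, ht, rfl⟩ := h.isPeak_iff.1 (isCodeword_iff_isPeak.1 hφ)
    have h1 := hmax _ hpeak
    rw [spread_radial h X ht.1.le, spread_radial h X zero_le_one] at h1
    have h2 : 1 ≤ t := le_of_mul_le_mul_right h1 hpos
    rw [le_antisymm ht.2 h2, one_smul]
  · rintro rfl
    rw [← one_smul ℝ (S.G X w)]
    refine ⟨hpeak, fun ψ hψ => ?_⟩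
    obtain ⟨t, ht, rfl⟩ := h.isPeak_iff.1 (isCodeword_iff_isPeak.1 hψ)
    rw [spread_radial h X ht.1.le, spread_radial h X zero_le_one]
    exact mul_le_mul_of_nonneg_right ht.2 hpos.le

section Bloch

variable {D : ℕ} {L : A ≃L[ℝ] ℝ × EuclideanSpace ℝ (Fin D)}

theorem image_states (h : IsRadial S.states S.G F μ w) (hL : S.IsBloch μ w L) :
    L '' S.states = {1} ×ˢ Metric.closedBall (0 : EuclideanSpace ℝ (Fin D)) 1 := by
  ext p
  constructor
  · rintro ⟨φ, hφ, rfl⟩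
    refine ⟨(hL.fst φ).trans hφ.2, ?_⟩
    obtain ⟨Y, t, ht, rfl⟩ := h.exists_eq S.G_continuous hφ
    rw [mem_closedBall_zero_iff, map_add, hL.map_centre, map_smul, Prod.snd_add, Prod.smul_snd,
      zero_add, norm_smul, hL.norm_rep, hL.norm_map, mul_one, Real.norm_of_nonneg ht.1]
    exact ht.2
  · rintro ⟨h1, h2⟩
    have hp : L (L.symm p - μ) = (0, p.2) := by
      rw [map_sub, L.apply_symm_apply, hL.map_centre]
      exact Prod.ext (sub_eq_zero.2 h1) (sub_zero _)
    obtain ⟨Y, hY⟩ := exists_eq_smul h hL (a := L.symm p - μ) (by rw [← hL.fst, hp])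
    rw [hp] at hY
    refine ⟨_, h.mem_of_mem_Icc Y ⟨norm_nonneg p.2, mem_closedBall_zero_iff.1 h2⟩, ?_⟩
    rw [← show L.symm p - μ = ‖p.2‖ • S.G Y w from hY]
    simp

theorem extremePoints_states (h : IsRadial S.states S.G F μ w)
    (hL : S.IsBloch μ w L) :
    Set.extremePoints ℝ S.states = range fun X => μ + S.G X w := by
  have hnt : Nontrivial (EuclideanSpace ℝ (Fin D)) :=
    ⟨⟨(L w).2, 0, by rw [← norm_ne_zero_iff, hL.norm_map]; exact one_ne_zero⟩⟩
  refine L.injective.image_injective ?_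
  rw [image_extremePoints, image_states h hL, extremePoints_prod, extremePoints_singleton,
    StrictConvexSpace.extremePoints_closedBall_eq_sphere, ← range_bloch h hL, ← range_comp]
  have hX : ∀ X, L (μ + S.G X w) = (1, (L (S.G X w)).2) := fun X => by
    refine Prod.ext ?_ ?_
    · rw [hL.fst, map_add, h.mem.2, unit_map, unit_of_isRadial h, add_zero]
    · rw [map_add, hL.map_centre, Prod.snd_add, zero_add]
  ext p
  constructor
  · rintro ⟨h1, X, hX2⟩
    exact ⟨X, (hX X).trans (Prod.ext h1.symm hX2)⟩
  · rintro ⟨X, rfl⟩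
    rw [Function.comp_apply, hX]
    exact ⟨rfl, X, rfl⟩

theorem exists_homeomorph_sphere (h : IsRadial S.states S.G F μ w) (hL : S.IsBloch μ w L) :
    ∃ e : SOd d ≃ₜ Metric.sphere (0 : EuclideanSpace ℝ (Fin D)) 1,
      ∀ X, (e X : EuclideanSpace ℝ (Fin D)) = (L (S.G X w)).2 := by
  let f : SOd d → Metric.sphere (0 : EuclideanSpace ℝ (Fin D)) 1 := fun X =>
    ⟨(L (S.G X w)).2, by rw [← range_bloch h hL]; exact ⟨X, rfl⟩⟩
  have hinj : Function.Injective f := fun X Y hXY => by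
    refine h.injective (L.injective (Prod.ext ?_ (congrArg Subtype.val hXY)))
    rw [hL.fst, hL.fst, unit_map, unit_map]
  have hsurj : Function.Surjective f := fun p => by
    obtain ⟨X, hX⟩ := (range_bloch h hL).symm.subset p.2
    exact ⟨X, Subtype.ext hX⟩
  have hcont : Continuous (Equiv.ofBijective f ⟨hinj, hsurj⟩) :=
    Continuous.subtype_mk (continuous_snd.comp (L.continuous.comp
      (continuous_rep_apply S.G_continuous w))) _
  exact ⟨hcont.homeoOfEquivCompactToT2, fun X => rfl⟩

end Bloch

/-- The structure theorem for frame bits. -/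
theorem IsFrameBit.structure_theorem (hd : 2 ≤ d) (hS : S.IsFrameBit) :
    (∃ (D : ℕ) (T : DynamicalStateSpace (ℝ × EuclideanSpace ℝ (Fin D)))
      (L : A ≃L[ℝ] (ℝ × EuclideanSpace ℝ (Fin D))) (ω : SOd d → A)
      (h : SOd d ≃ₜ Metric.sphere (0 : EuclideanSpace ℝ (Fin D)) 1),
      IsEuclideanBall T ∧ IsDynamicalEquiv S.toDynamicalStateSpace T L ∧
      (∀ X φ, S.IsMaximalCodeword X φ ↔ φ = ω X) ∧
      Set.extremePoints ℝ S.states = Set.range ω ∧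
      (∀ X, L (ω X) = (1, (h X : EuclideanSpace ℝ (Fin D)))) ∧
      D = 2) ∧
    d = 2 := by
  obtain ⟨μ, w, h⟩ := hS.exists_isRadial hd
  obtain ⟨D, L, hL⟩ := exists_isBloch hd h
  obtain rfl := two_of_isRadial hd h hL
  obtain ⟨e, he⟩ := exists_homeomorph_sphere h hL
  refine ⟨⟨D, S.toDynamicalStateSpace.map L, L, fun X => μ + S.G X w, e, ⟨fun p => ?_, ?_⟩,
    S.isDynamicalEquiv_map L, fun X φ => isMaximalCodeword_iff hd h, extremePoints_states h hL,
    fun X => ?_, dim_eq_two h hL⟩, rfl⟩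
  · change S.unit (L.symm p) = p.1
    rw [← hL.fst, L.apply_symm_apply]
  · refine (S.toStateSpace.states_map L).trans ((image_states h hL).trans ?_)
    ext p
    simp
  · refine Prod.ext ?_ ?_
    · rw [hL.fst, map_add, h.mem.2, unit_map, unit_of_isRadial h, add_zero]
    · rw [map_add, hL.map_centre, Prod.snd_add, zero_add, he]

end RotationStateSpace

/-- Radiality depends on the functional only up to positive affine transformations. -/
theorem IsRadial.congr {K : Type*} [Group K] {A : Type*} [NormedAddCommGroup A] [NormedSpace ℝ A]
    {Ω : Set A} {G : K →* (A ≃L[ℝ] A)} {F F' : A →L[ℝ] ℝ} {μ w : A} (h : IsRadial Ω G F μ w)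
    {a b : ℝ} (ha : 0 < a) (hF : ∀ φ ∈ Ω, F φ = a * F' φ + b) : IsRadial Ω G F' μ w where
  convex := h.convex
  invariant := h.invariant
  mem := h.mem
  fixed := h.fixed
  isPeak := by
    refine isPeak_one_iff.2 ⟨h.isPeak.1, fun Y hY => ?_⟩
    have h1 := (isPeak_one_iff.1 h.isPeak).2 Y hY
    rw [hF _ h.isPeak.1, hF _ (h.invariant Y _ h.isPeak.1)] at h1
    exact lt_of_mul_lt_mul_left (by linarith) ha.le
  exists_eq_of_forall_le := fun φ hφ hle => h.exists_eq_of_forall_le φ hφ fun Y => by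
    rw [hF _ hφ, hF _ (h.invariant Y _ hφ)]
    linarith [mul_le_mul_of_nonneg_left (hle Y) ha.le]
  balanced := h.balanced

/-! ### Plane rotations acting simply transitively on unit vectors -/

section Plane

theorem toEuclideanLin_planeRotation_zero {a b : ℝ} (h : a ^ 2 + b ^ 2 = 1)
    (x : EuclideanSpace ℝ (Fin 2)) :
    Matrix.toEuclideanLin (planeRotation a b h : Matrix (Fin 2) (Fin 2) ℝ) x 0 =
      a * x 0 - b * x 1 := by
  simp [planeRotation, Matrix.toEuclideanLin, Matrix.mulVec, dotProduct, sub_eq_add_neg]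

theorem toEuclideanLin_planeRotation_one {a b : ℝ} (h : a ^ 2 + b ^ 2 = 1)
    (x : EuclideanSpace ℝ (Fin 2)) :
    Matrix.toEuclideanLin (planeRotation a b h : Matrix (Fin 2) (Fin 2) ℝ) x 1 =
      b * x 0 + a * x 1 := by
  simp [planeRotation, Matrix.toEuclideanLin, Matrix.mulVec, dotProduct]

theorem norm_eq_one_iff_plane (x : EuclideanSpace ℝ (Fin 2)) :
    ‖x‖ = 1 ↔ x 0 ^ 2 + x 1 ^ 2 = 1 := by
  rw [← sq_eq_sq₀ (norm_nonneg _) zero_le_one, EuclideanSpace.real_norm_sq_eq, Fin.sum_univ_two,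
    one_pow]

theorem norm_toEuclideanLin_SOd_two (R : SOd 2) (x : EuclideanSpace ℝ (Fin 2)) :
    ‖Matrix.toEuclideanLin (R : Matrix (Fin 2) (Fin 2) ℝ) x‖ = ‖x‖ := by
  obtain ⟨a, b, h, rfl⟩ := exists_eq_planeRotation R
  rw [← sq_eq_sq₀ (norm_nonneg _) (norm_nonneg _), EuclideanSpace.real_norm_sq_eq,
    EuclideanSpace.real_norm_sq_eq, Fin.sum_univ_two, Fin.sum_univ_two,
    toEuclideanLin_planeRotation_zero, toEuclideanLin_planeRotation_one]
  linear_combination (x 0 ^ 2 + x 1 ^ 2) * h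

theorem exists_toEuclideanLin_eq {x y : EuclideanSpace ℝ (Fin 2)} (hx : ‖x‖ = 1) (hy : ‖y‖ = 1) :
    ∃ R : SOd 2, Matrix.toEuclideanLin (R : Matrix (Fin 2) (Fin 2) ℝ) x = y := by
  rw [norm_eq_one_iff_plane] at hx hy
  refine ⟨planeRotation (x 0 * y 0 + x 1 * y 1) (x 0 * y 1 - x 1 * y 0) (by
    linear_combination (y 0 ^ 2 + y 1 ^ 2) * hx + hy), ?_⟩
  ext i
  fin_cases i
  · refine (toEuclideanLin_planeRotation_zero _ x).trans ?_
    change _ = y 0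
    linear_combination y 0 * hx
  · refine (toEuclideanLin_planeRotation_one _ x).trans ?_
    change _ = y 1
    linear_combination y 1 * hx

theorem toEuclideanLin_injective {x : EuclideanSpace ℝ (Fin 2)} (hx : ‖x‖ = 1) {R T : SOd 2}
    (h : Matrix.toEuclideanLin (R : Matrix (Fin 2) (Fin 2) ℝ) x =
      Matrix.toEuclideanLin (T : Matrix (Fin 2) (Fin 2) ℝ) x) : R = T := by
  rw [norm_eq_one_iff_plane] at hx
  obtain ⟨a, b, h1, rfl⟩ := exists_eq_planeRotation R
  obtain ⟨a', b', h2, rfl⟩ := exists_eq_planeRotation T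
  have e0 := congrArg (fun v : EuclideanSpace ℝ (Fin 2) => v 0) h
  have e1 := congrArg (fun v : EuclideanSpace ℝ (Fin 2) => v 1) h
  simp only [toEuclideanLin_planeRotation_zero, toEuclideanLin_planeRotation_one] at e0 e1
  have ha : a = a' := by linear_combination x 0 * e0 + x 1 * e1 - (a - a') * hx
  have hb : b = b' := by linear_combination x 0 * e1 - x 1 * e0 - (b - b') * hx
  subst ha hb
  rfl

theorem toEuclideanLin_planeNeg_mul (R : SOd 2) (x : EuclideanSpace ℝ (Fin 2)) :
    Matrix.toEuclideanLin ((planeNeg * R : SOd 2) : Matrix (Fin 2) (Fin 2) ℝ) x =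
      -Matrix.toEuclideanLin (R : Matrix (Fin 2) (Fin 2) ℝ) x := by
  have : ((planeNeg * R : SOd 2) : Matrix (Fin 2) (Fin 2) ℝ) = -(R : Matrix (Fin 2) (Fin 2) ℝ) := by
    change (planeNeg : Matrix (Fin 2) (Fin 2) ℝ) * R = _
    rw [coe_planeNeg, neg_mul, one_mul]
  rw [this, map_neg]
  rfl

end Plane

/-! ### Frame bits and direction bits in the plane -/

namespace RotationStateSpace

variable {A : Type*} [NormedAddCommGroup A] [NormedSpace ℝ A] [FiniteDimensional ℝ A]
  {S : RotationStateSpace 2 A} {F : A →L[ℝ] ℝ} {μ w : A}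

theorem map_planeNeg (h : IsRadial S.states S.G F μ w) {a : A} (ha : S.unit a = 0) :
    S.G planeNeg a = -a := by
  obtain ⟨D, L, hL⟩ := exists_isBloch le_rfl h
  exact map_eq_neg_of_involution h hL planeNeg_mul_self planeNeg_ne_one ha

/-- The rotation by `π` reverses the radial part, so weights `(1 ± s / t) / 2` on the identity and
this rotation scale it by exactly `s / t`. -/
theorem isNoisier_of_radial (h : IsRadial S.states S.G S.M μ w) (X : SOd 2) {s t : ℝ} (hs : 0 < s)
    (hst : s < t) : S.IsNoisier (μ + s • S.G X w) (μ + t • S.G X w) := by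
  have ht : 0 < t := hs.trans hst
  have h1 : s / t < 1 := (div_lt_one ht).2 hst
  have h0 : 0 < s / t := div_pos hs ht
  refine ⟨2, ![(1 + s / t) / 2, (1 - s / t) / 2], ![1, planeNeg], fun j => ?_, ?_, ?_, fun Y => ?_⟩
  · fin_cases j <;> constructor <;> simp <;> linarith
  · rw [Fin.sum_univ_two]
    simp only [Matrix.cons_val_zero, Matrix.cons_val_one]
    ring
  · intro i j hij
    fin_cases i <;> fin_cases j <;> simp_all [planeNeg_ne_one, planeNeg_ne_one.symm]
  · have hneg : S.M (S.G ((planeNeg * Y)⁻¹ * X) w) = -S.M (S.G (Y⁻¹ * X) w) := by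
      rw [mul_inv_rev, planeNeg_inv, mul_comm_SOd_two Y⁻¹, mul_assoc, rep_mul_apply,
        map_planeNeg h (by rw [unit_map, unit_of_isRadial h]), map_neg]
    rw [Fin.sum_univ_two]
    simp only [Matrix.cons_val_zero, Matrix.cons_val_one, frameEffect_radial h, one_mul, hneg]
    field_simp
    ring

theorem isFrameBit_iff_exists_isRadial :
    S.IsFrameBit ↔ ∃ μ w, IsRadial S.states S.G S.M μ w := by
  refine ⟨fun h => h.exists_isRadial le_rfl, ?_⟩
  rintro ⟨μ, w, h⟩
  have := nontrivial_SOd (le_refl 2)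
  refine ⟨⟨_, h.isPeak⟩, fun ω ω' hne X hω hω' => ?_⟩
  obtain ⟨t, ht, rfl⟩ := h.isPeak_iff.1 (isCodeword_iff_isPeak.1 hω)
  obtain ⟨s, hs, rfl⟩ := h.isPeak_iff.1 (isCodeword_iff_isPeak.1 hω')
  rcases lt_trichotomy s t with hst | rfl | hst
  · exact Or.inl (isNoisier_of_radial h X hs.1 hst)
  · exact absurd rfl hne
  · exact Or.inr (isNoisier_of_radial h X ht.1 hst)

/-- The functional `M - M ∘ G(-1)`. -/
def oddEffect (S : RotationStateSpace 2 A) : A →L[ℝ] ℝ :=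
  S.M - S.M.comp (S.G planeNeg : A →L[ℝ] A)

theorem oddEffect_apply (a : A) : S.oddEffect a = S.M a - S.M (S.G planeNeg a) := rfl

/-- The rotation by `π` reflects states in `μ`. Radiality for any `F` suffices, which lets it be
passed between `S.M` and `S.oddEffect` in both directions. -/
theorem oddEffect_eq (h : IsRadial S.states S.G F μ w) {φ : A} (hφ : φ ∈ S.states) :
    S.oddEffect φ = 2 * S.M φ + -(2 * S.M μ) := by
  have h1 : φ = μ + (φ - μ) := by abel
  have h2 := map_planeNeg h (a := φ - μ) (by rw [map_sub, hφ.2, h.mem.2, sub_self])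
  rw [oddEffect_apply]
  have h3 : S.G planeNeg φ = μ - (φ - μ) := by
    conv_lhs => rw [h1]
    rw [map_add, h.fixed, h2]
    abel
  rw [h3, map_sub, map_sub]
  ring

theorem isRadial_oddEffect_iff :
    IsRadial S.states S.G S.oddEffect μ w ↔ IsRadial S.states S.G S.M μ w := by
  refine ⟨fun h => h.congr two_pos fun φ hφ => oddEffect_eq h hφ, fun h =>
    h.congr (a := 1 / 2) (b := S.M μ) (by norm_num) fun φ hφ => ?_⟩
  rw [oddEffect_eq h hφ]
  ring

/-- In the plane `R ↦ R x` is a bijection onto the unit circle and `-R x` is the image of `x` under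
`planeNeg * R`, so unique maxima over directions are peaks over rotations. -/
theorem isUniqueMaxDirection_iff {N : EuclideanSpace ℝ (Fin 2) → (A →L[ℝ] ℝ)}
    {x : EuclideanSpace ℝ (Fin 2)} (hx : ‖x‖ = 1)
    (hN : ∀ R : SOd 2, N (Matrix.toEuclideanLin (R : Matrix (Fin 2) (Fin 2) ℝ) x) =
      S.M.comp (S.G R⁻¹ : A →L[ℝ] A)) :
    (∀ (R : SOd 2) ω, N (Matrix.toEuclideanLin (R : Matrix (Fin 2) (Fin 2) ℝ) x) ω -
        N (-Matrix.toEuclideanLin (R : Matrix (Fin 2) (Fin 2) ℝ) x) ω =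
        S.oddEffect (S.G R⁻¹ ω)) ∧
      ∀ (R : SOd 2) ω, ω ∈ S.states →
        (IsUniqueMaxDirection N ω (Matrix.toEuclideanLin (R : Matrix (Fin 2) (Fin 2) ℝ) x) ↔
          IsPeak S.states S.G S.oddEffect R ω) := by
  have hdiff : ∀ (R : SOd 2) ω, N (Matrix.toEuclideanLin (R : Matrix (Fin 2) (Fin 2) ℝ) x) ω -
      N (-Matrix.toEuclideanLin (R : Matrix (Fin 2) (Fin 2) ℝ) x) ω =
      S.oddEffect (S.G R⁻¹ ω) := by
    intro R ω
    rw [← toEuclideanLin_planeNeg_mul, hN, hN, oddEffect_apply, ← rep_mul_apply, mul_inv_rev,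
      planeNeg_inv, mul_comm_SOd_two R⁻¹]
    rfl
  refine ⟨hdiff, fun R ω hω => ⟨fun h => ⟨hω, fun Y hY => ?_⟩, fun h => ⟨?_, ?_⟩⟩⟩
  · rw [← hdiff, ← hdiff]
    exact h.2 _ (by rw [norm_toEuclideanLin_SOd_two, hx])
      fun he => hY (toEuclideanLin_injective hx he)
  · rw [norm_toEuclideanLin_SOd_two, hx]
  · intro y hy hne
    obtain ⟨Y, rfl⟩ := exists_toEuclideanLin_eq hx hy
    rw [hdiff, hdiff]
    refine h.2 Y ?_
    rintro rfl
    exact hne rfl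

/-- In the plane, frame bits are the same as direction bits. -/
theorem isFrameBit_iff_isDirectionBit {x : EuclideanSpace ℝ (Fin 2)} (hx : ‖x‖ = 1) :
    S.IsFrameBit ↔ S.IsDirectionBit x := by
  rw [isFrameBit_iff_exists_isRadial]
  have hone : Matrix.toEuclideanLin ((1 : SOd 2) : Matrix (Fin 2) (Fin 2) ℝ) x = x := by
    change Matrix.toEuclideanLin (1 : Matrix (Fin 2) (Fin 2) ℝ) x = x
    simp
  have := nontrivial_SOd (le_refl 2)
  constructor
  · rintro ⟨μ, w, h⟩
    have ho := isRadial_oddEffect_iff.2 h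
    classical
    -- On the unit circle the rotation is unique, so the choice is harmless; the value `0` elsewhere
    -- is never used.
    let N : EuclideanSpace ℝ (Fin 2) → (A →L[ℝ] ℝ) := fun y =>
      if hy : ∃ R : SOd 2, Matrix.toEuclideanLin (R : Matrix (Fin 2) (Fin 2) ℝ) x = y then
        S.M.comp (S.G hy.choose⁻¹ : A →L[ℝ] A) else 0
    have hN : ∀ R : SOd 2, N (Matrix.toEuclideanLin (R : Matrix (Fin 2) (Fin 2) ℝ) x) =
        S.M.comp (S.G R⁻¹ : A →L[ℝ] A) := by
      intro R
      have hy : ∃ T : SOd 2, Matrix.toEuclideanLin (T : Matrix (Fin 2) (Fin 2) ℝ) x =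
          Matrix.toEuclideanLin (R : Matrix (Fin 2) (Fin 2) ℝ) x := ⟨R, rfl⟩
      simp only [N, dif_pos hy]
      rw [toEuclideanLin_injective hx hy.choose_spec]
    obtain ⟨hdiff, hiff⟩ := isUniqueMaxDirection_iff hx hN
    refine ⟨N, hN, ⟨μ + w, h.isPeak.1, ?_⟩, fun ω hω ω' hω' y hy hy' he => ?_⟩
    · have := (hiff 1 (μ + w) h.isPeak.1).2 ho.isPeak
      rwa [hone] at this
    · obtain ⟨Y, rfl⟩ := exists_toEuclideanLin_eq hx hy.1
      rw [hdiff, hdiff] at he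
      obtain ⟨s, hs, rfl⟩ := ho.isPeak_iff.1 ((hiff Y ω hω).1 hy)
      obtain ⟨t, ht, rfl⟩ := ho.isPeak_iff.1 ((hiff Y ω' hω').1 hy')
      simp only [map_add, map_smul, ho.fixed, ← rep_mul_apply, inv_mul_cancel, rep_one_apply,
        smul_eq_mul] at he
      -- The strict peak at `w` exceeds the value at `-w`, its image under the rotation by `π`.
      have hpos : S.oddEffect w ≠ 0 := by
        have := ho.map_lt planeNeg_ne_one
        rw [map_planeNeg ho (unit_of_isRadial ho), map_neg] at this
        intro h0
        rw [h0] at this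
        simp at this
      rw [mul_right_cancel₀ hpos (add_left_cancel he)]
  · rintro ⟨N, hN, ⟨ω, hω, hmax⟩, hinj⟩
    obtain ⟨hdiff, hiff⟩ := isUniqueMaxDirection_iff hx hN
    obtain ⟨μ, w, h⟩ := RotationStateSpace.exists_isRadial (S := S) (F := S.oddEffect) le_rfl
      ⟨ω, (hiff 1 ω hω).1 (by rwa [hone])⟩ fun φ φ' hφ hφ' he =>
        hinj φ hφ.1 φ' hφ'.1 _ ((hiff 1 φ hφ.1).2 hφ) ((hiff 1 φ' hφ'.1).2 hφ') (by
          rw [hdiff, hdiff, inv_one, rep_one_apply, rep_one_apply, he])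
    exact ⟨μ, w, isRadial_oddEffect_iff.1 h⟩

end RotationStateSpace

/-! ### The unit disc as a frame bit -/

section Disc

/-- The cone over the unit disc. -/
def discCone : PointedCone ℝ (ℝ × EuclideanSpace ℝ (Fin 2)) where
  carrier := {p | ‖p.2‖ ≤ p.1}
  add_mem' := fun {p q} hp hq => (norm_add_le p.2 q.2).trans (add_le_add hp hq)
  zero_mem' := by simp
  smul_mem' := fun c p hp => by
    change ‖(c : ℝ) • p.2‖ ≤ (c : ℝ) * p.1
    rw [norm_smul, Real.norm_of_nonneg c.2]
    exact mul_le_mul_of_nonneg_left hp c.2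

theorem mem_discCone {p : ℝ × EuclideanSpace ℝ (Fin 2)} : p ∈ discCone ↔ ‖p.2‖ ≤ p.1 := Iff.rfl

/-- The product carries the maximum norm, so on the cone the order unit is the norm. -/
theorem norm_of_mem_discCone {p : ℝ × EuclideanSpace ℝ (Fin 2)} (hp : p ∈ discCone) :
    ‖p‖ = p.1 := by
  rw [mem_discCone] at hp
  rw [Prod.norm_def, Real.norm_of_nonneg ((norm_nonneg _).trans hp), max_eq_left hp]

/-- The state space of the unit disc, with all effects allowed. -/
def discStateSpace : StateSpace (ℝ × EuclideanSpace ℝ (Fin 2)) where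
  cone := discCone
  cone_closed := isClosed_le (continuous_norm.comp continuous_snd) continuous_fst
  cone_full := by
    refine Submodule.eq_top_of_nonempty_interior' _ ⟨((1 : ℝ), 0), ?_⟩
    refine interior_mono Submodule.subset_span (mem_interior.2 ⟨{p | ‖p.2‖ < p.1}, ?_, ?_, ?_⟩)
    · exact fun p hp => le_of_lt (α := ℝ) hp
    · exact isOpen_lt (continuous_norm.comp continuous_snd) continuous_fst
    · simp
  cone_salient := fun p hp hp' => by
    rw [mem_discCone] at hp hp'
    simp only [Prod.snd_neg, norm_neg, Prod.fst_neg] at hp'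
    have h0 := norm_nonneg p.2
    exact Prod.ext (by simp; linarith) (norm_eq_zero.1 (by linarith))
  unit := ContinuousLinearMap.fst ℝ ℝ _
  unit_pos := fun p hp h0 => by
    rw [ContinuousLinearMap.coe_fst', ← norm_of_mem_discCone hp]
    exact norm_pos_iff.2 h0
  effects := {M | ∀ p ∈ discCone, 0 ≤ M p ∧ M p ≤ p.1}
  effects_closed := by
    have hev : ∀ p, Continuous fun M : ℝ × EuclideanSpace ℝ (Fin 2) →L[ℝ] ℝ => M p := fun p =>
      (ContinuousLinearMap.apply ℝ ℝ p).continuous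
    simp only [ofPred_forall]
    exact isClosed_iInter fun p => isClosed_iInter fun _ =>
      (isClosed_le continuous_const (hev p)).inter (isClosed_le (hev p) continuous_const)
  effects_convex := by
    intro M hM M' hM' a b ha hb hab p hp
    obtain ⟨h1, h2⟩ := hM p hp
    obtain ⟨h3, h4⟩ := hM' p hp
    refine ⟨by simp only [add_apply, smul_apply, smul_eq_mul]; positivity, ?_⟩
    simp only [add_apply, smul_apply, smul_eq_mul]
    calc a * M p + b * M' p ≤ a * p.1 + b * p.1 := by gcongr
      _ = p.1 := by rw [← add_mul, hab, one_mul]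
  effects_full := by
    refine top_le_iff.1 ?_
    -- Functionals within `1 / 4` of half the order unit take values between `p.1 / 4` and `3 * p.1
    -- / 4` on the cone, so an open ball consists of effects.
    rw [← Metric.isOpen_ball.affineSpan_eq_top
      ⟨_, Metric.mem_ball_self (x := (1 / 2 : ℝ) • ContinuousLinearMap.fst ℝ ℝ
        (EuclideanSpace ℝ (Fin 2))) (ε := 1 / 4) (by norm_num)⟩]
    refine affineSpan_mono ℝ fun M hM p hp => ?_
    rw [mem_ball_iff_norm] at hM
    have h1 := ContinuousLinearMap.le_of_opNorm_le _ hM.le p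
    rw [norm_of_mem_discCone hp, Real.norm_eq_abs, abs_le] at h1
    have h2 : 0 ≤ p.1 := (norm_nonneg _).trans hp
    simp only [sub_apply, smul_apply, ContinuousLinearMap.coe_fst', smul_eq_mul] at h1
    constructor <;> linarith [h1.1, h1.2]
  unit_mem_effects := fun p hp => ⟨(norm_nonneg _).trans hp, le_rfl⟩
  effects_nonneg := fun M hM p hp => (hM p hp).1
  effects_le_unit := fun M hM p hp => (hM p hp).2

/-- The action of the planar rotations on `ℝ × ℝ²`. -/
def discRep : SOd 2 →* ((ℝ × EuclideanSpace ℝ (Fin 2)) ≃L[ℝ] (ℝ × EuclideanSpace ℝ (Fin 2))) :=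
  (ContinuousLinearEquiv.unitsEquiv ℝ (ℝ × EuclideanSpace ℝ (Fin 2))).toMonoidHom.comp
    (MonoidHom.toHomUnits
      { toFun := fun R => (ContinuousLinearMap.id ℝ ℝ).prodMap
          (Matrix.toEuclideanCLM (𝕜 := ℝ) (R : Matrix (Fin 2) (Fin 2) ℝ))
        map_one' := by
          change (ContinuousLinearMap.id ℝ ℝ).prodMap (Matrix.toEuclideanCLM (𝕜 := ℝ)
            (1 : Matrix (Fin 2) (Fin 2) ℝ)) = _
          rw [map_one]
          rfl
        map_mul' := fun R T => by
          change (ContinuousLinearMap.id ℝ ℝ).prodMap (Matrix.toEuclideanCLM (𝕜 := ℝ)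
            ((R : Matrix (Fin 2) (Fin 2) ℝ) * (T : Matrix (Fin 2) (Fin 2) ℝ))) = _
          rw [map_mul]
          rfl })

theorem discRep_apply (R : SOd 2) (p : ℝ × EuclideanSpace ℝ (Fin 2)) :
    discRep R p = (p.1, Matrix.toEuclideanLin (R : Matrix (Fin 2) (Fin 2) ℝ) p.2) := rfl

theorem continuous_discRep : Continuous fun R : SOd 2 =>
    (discRep R : (ℝ × EuclideanSpace ℝ (Fin 2)) →L[ℝ] (ℝ × EuclideanSpace ℝ (Fin 2))) := by
  have h1 : Continuous fun R : Matrix (Fin 2) (Fin 2) ℝ => Matrix.toEuclideanCLM (𝕜 := ℝ) R :=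
    LinearMap.continuous_of_finiteDimensional
      (Matrix.toEuclideanCLM (𝕜 := ℝ) (n := Fin 2)).toAlgEquiv.toLinearMap
  exact (ContinuousLinearMap.prodMapL ℝ ℝ ℝ (EuclideanSpace ℝ (Fin 2))
    (EuclideanSpace ℝ (Fin 2))).continuous.comp
      (continuous_const.prodMk (h1.comp continuous_subtype_val))

theorem discRep_mem_cone {R : SOd 2} {p : ℝ × EuclideanSpace ℝ (Fin 2)} :
    discRep R p ∈ discCone ↔ p ∈ discCone := by
  rw [mem_discCone, mem_discCone, discRep_apply, norm_toEuclideanLin_SOd_two]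

/-- The disc with its group of rotations and the effect `(x₀, r) ↦ (x₀ + r₀) / 2`. -/
def discSystem : RotationStateSpace 2 (ℝ × EuclideanSpace ℝ (Fin 2)) where
  toStateSpace := discStateSpace
  transf := discRep.range
  transf_compact := by
    convert isCompact_range continuous_discRep using 1
    ext T
    simp
  transf_states := by
    rintro _ ⟨R, rfl⟩
    have hsub : ∀ R, ∀ p ∈ discStateSpace.states, discRep R p ∈ discStateSpace.states :=
      fun R p hp => ⟨discRep_mem_cone.2 hp.1, hp.2⟩
    refine Subset.antisymm (image_subset_iff.2 fun p hp => hsub R p hp) fun p hp => ?_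
    exact ⟨discRep R⁻¹ p, hsub _ p hp, rep_apply_inv_apply _ _ _⟩
  transf_effects := by
    rintro _ ⟨R, rfl⟩
    have hsub : ∀ R, ∀ M ∈ discStateSpace.effects,
        M.comp (discRep R : (ℝ × EuclideanSpace ℝ (Fin 2)) →L[ℝ] (ℝ × EuclideanSpace ℝ (Fin 2)))
          ∈ discStateSpace.effects :=
      fun R M hM p hp => hM (discRep R p) (discRep_mem_cone.2 hp)
    refine Subset.antisymm (image_subset_iff.2 fun M hM => hsub R M hM) fun M hM => ?_
    refine ⟨_, hsub R⁻¹ M hM, ContinuousLinearMap.ext fun p => ?_⟩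
    change M (discRep R⁻¹ (discRep R p)) = M p
    rw [rep_inv_apply_apply]
  G := discRep
  G_continuous := continuous_discRep
  G_mem := fun R => ⟨R, rfl⟩
  M := (1 / 2 : ℝ) • (ContinuousLinearMap.fst ℝ ℝ (EuclideanSpace ℝ (Fin 2)) +
    (EuclideanSpace.proj 0).comp (ContinuousLinearMap.snd ℝ ℝ (EuclideanSpace ℝ (Fin 2))))
  M_mem := fun p hp => by
    have h1 : |p.2 0| ≤ p.1 := (PiLp.norm_apply_le p.2 0).trans hp
    rw [abs_le] at h1
    change 0 ≤ 1 / 2 * (p.1 + p.2 0) ∧ 1 / 2 * (p.1 + p.2 0) ≤ p.1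
    constructor <;> linarith [h1.1, h1.2]

theorem discSystem_M_apply (p : ℝ × EuclideanSpace ℝ (Fin 2)) :
    discSystem.M p = 1 / 2 * (p.1 + p.2 0) := rfl

theorem discSystem_M_rep {a b : ℝ} (h : a ^ 2 + b ^ 2 = 1) (p : ℝ × EuclideanSpace ℝ (Fin 2)) :
    discSystem.M (discSystem.G (planeRotation a b h) p) =
      1 / 2 * (p.1 + (a * p.2 0 - b * p.2 1)) := by
  rw [← toEuclideanLin_planeRotation_zero h]
  rfl

theorem planeRotation_eq_one_iff {a b : ℝ} (h : a ^ 2 + b ^ 2 = 1) :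
    planeRotation a b h = 1 ↔ a = 1 ∧ b = 0 := by
  constructor
  · intro he
    have h0 := congrArg (fun R : SOd 2 => (R : Matrix (Fin 2) (Fin 2) ℝ) 0 0) he
    have h1 := congrArg (fun R : SOd 2 => (R : Matrix (Fin 2) (Fin 2) ℝ) 1 0) he
    exact ⟨by simpa [planeRotation] using h0, by simpa [planeRotation] using h1⟩
  · rintro ⟨rfl, rfl⟩
    refine Subtype.ext ?_
    change !![(1 : ℝ), -0; 0, 1] = 1
    rw [Matrix.one_fin_two, neg_zero]

/-- A codeword of the disc for the trivial rotation points in the first coordinate direction. -/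
theorem discSystem_isPeak_snd {p : ℝ × EuclideanSpace ℝ (Fin 2)}
    (hp : IsPeak discSystem.states discSystem.G discSystem.M 1 p) : p.2 1 = 0 := by
  by_contra hne
  set n := Real.sqrt (p.2 0 ^ 2 + p.2 1 ^ 2) with hn
  have hn2 : n ^ 2 = p.2 0 ^ 2 + p.2 1 ^ 2 := Real.sq_sqrt (by positivity)
  have hpos : 0 < n := Real.sqrt_pos.2 (by positivity)
  -- These are the entries of the rotation that turns `p.2` onto the positive first axis, where the
  -- first coordinate becomes `n ≥ p.2 0`.
  have hab : (p.2 0 / n) ^ 2 + (-(p.2 1 / n)) ^ 2 = 1 := by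
    field_simp
    exact hn2.symm
  have hR : planeRotation _ _ hab ≠ 1 := by
    rw [Ne, planeRotation_eq_one_iff]
    rintro ⟨-, h1⟩
    rw [neg_eq_zero, div_eq_zero_iff] at h1
    exact h1.elim hne hpos.ne'
  have h1 := (isPeak_one_iff.1 hp).2 _ hR
  rw [discSystem_M_rep, discSystem_M_apply] at h1
  have h2 : p.2 0 / n * p.2 0 - -(p.2 1 / n) * p.2 1 = n := by
    field_simp
    linarith
  rw [h2] at h1
  nlinarith [sq_nonneg (p.2 1)]

/-- By the radial criterion it suffices that a peak exists and is determined by its value: a peak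
has vanishing second coordinate, and `M` reads off the first. -/
theorem discSystem_isFrameBit : discSystem.IsFrameBit := by
  refine RotationStateSpace.isFrameBit_iff_exists_isRadial.2
    (RotationStateSpace.exists_isRadial le_rfl ⟨(1, EuclideanSpace.single 0 1), ?_⟩ ?_)
  · refine isPeak_one_iff.2 ⟨⟨?_, rfl⟩, fun Y hY => ?_⟩
    · exact mem_discCone.2 (by simp)
    · obtain ⟨a, b, h, rfl⟩ := exists_eq_planeRotation Y
      rw [discSystem_M_rep, discSystem_M_apply]
      have ha : a < 1 := by
        by_contra! hcon
        have hb : b = 0 := by nlinarith [sq_nonneg b]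
        refine hY ((planeRotation_eq_one_iff h).2 ⟨?_, hb⟩)
        nlinarith
      simpa using ha
  · intro p q hp hq he
    have hp1 : p.1 = 1 := hp.1.2
    have hq1 : q.1 = 1 := hq.1.2
    rw [discSystem_M_apply, discSystem_M_apply, hp1, hq1] at he
    refine Prod.ext (hp1.trans hq1.symm) ?_
    ext i
    fin_cases i
    · change p.2 0 = q.2 0
      linarith
    · exact (discSystem_isPeak_snd hp).trans (discSystem_isPeak_snd hq).symm

end Disc

end

theorem mainTheorem4 :
    -- every frame bit is a Euclidean ball, its pure states are the states `ω X`, the map from `X`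
    -- to the Bloch vector of `ω X` is a homeomorphism onto the unit sphere, and `d = 2`
    (∀ (d : ℕ), 2 ≤ d →
      ∀ (A : Type*) [NormedAddCommGroup A] [NormedSpace ℝ A] [FiniteDimensional ℝ A]
        (S : RotationStateSpace d A), S.IsFrameBit →
        (∃ (D : ℕ) (T : DynamicalStateSpace (ℝ × EuclideanSpace ℝ (Fin D)))
          (L : A ≃L[ℝ] (ℝ × EuclideanSpace ℝ (Fin D))) (ω : SOd d → A)
          (h : SOd d ≃ₜ Metric.sphere (0 : EuclideanSpace ℝ (Fin D)) 1),
          IsEuclideanBall T ∧ IsDynamicalEquiv S.toDynamicalStateSpace T L ∧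
          (∀ X φ, S.IsMaximalCodeword X φ ↔ φ = ω X) ∧
          Set.extremePoints ℝ S.states = Set.range ω ∧
          (∀ X, L (ω X) = (1, (h X : EuclideanSpace ℝ (Fin D)))) ∧
          D = 2) ∧
        d = 2) ∧
    -- for `d = 2`, frame bits are the same as direction bits
    (∀ (A : Type*) [NormedAddCommGroup A] [NormedSpace ℝ A] [FiniteDimensional ℝ A]
      (S : RotationStateSpace 2 A) (x : EuclideanSpace ℝ (Fin 2)), ‖x‖ = 1 →
      (S.IsFrameBit ↔ S.IsDirectionBit x)) ∧
    -- for `d = 2`, frame bits exist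
    (∃ S : RotationStateSpace 2 (ℝ × EuclideanSpace ℝ (Fin 2)), S.IsFrameBit) := by
  refine ⟨fun d hd A _ _ _ S hS => hS.structure_theorem hd, fun A _ _ _ S x hx => ?_,
    discSystem, discSystem_isFrameBit⟩
  exact RotationStateSpace.isFrameBit_iff_isDirectionBit hx
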